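/- Let $n\ge 2$, let $\gamma_1,\dots,\gamma_{n-1}\ge 1$, and put $\gamma=1+\gamma_1+\dots+\gamma_{n-1}$ and $$\Omega_\gamma=\{x\in\mathbb R^n: 0<x_n<1,\ 0<x_i<x_n^{\gamma_i},\ i=1,\dots,n-1\}.$$ Let $\Omega_n$ be this domain in the case $\gamma_1=\dots=\gamma_{n-1}=1$. For $a>0$ define $\varphi_a:\Omega_n\to\Omega_\gamma$ by $$\varphi_a(x)=\Big(\tfrac{x_1}{x_n}\,x_n^{a\gamma_1},\dots,\tfrac{x_{n-1}}{x_n}\,x_n^{a\gamma_{n-1}},\,x_n^a\Big).$$ Definitions. Let $\Omega,\widetilde\Omega\subset\mathbb R^n$ be domains, let $w:\mathbb R^n\to[0,\infty)$ be a weight and let $1<s<p<\infty$. The space $L^1_p(\Omega,w)$ consists of the locally integrable, weakly differentiable functions $f:\Omega\to\mathbb R$ with finite seminorm $\|f\|_{L^1_p(\Omega,w)}=\big(\int_\Omega|\nabla f|^p w\,dx\big)^{1/p}$, and $L^1_s(\Omega)=L^1_s(\Omega,1)$. A homeomorphism $\varphi$ of $\Omega$ onto $\widetilde\Omega$ is called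 $w$-weighted $(p,s)$-quasiconformal if $\varphi\in W^1_{1,\mathrm{loc}}(\Omega)$, $D\varphi=0$ almost everywhere on $\{x\in\Omega:|J(x,\varphi)|\,w(\varphi(x))=0\}$, and $$K_{p,s}(\varphi;\Omega)=\left(\int_\Omega\left(\frac{|D\varphi(x)|^p}{|J(x,\varphi)|\,w(\varphi(x))}\right)^{\frac{s}{p-s}}dx\right)^{\frac{p-s}{ps}}<\infty ,$$ where $|D\varphi(x)|$ is the operator norm, $J(x,\varphi)=\det D\varphi(x)$ and $0/0=0$. The map $\varphi$ has the Luzin $N$-property if it maps subsets of $\Omega$ of Lebesgue measure zero to sets of measure zero. By $\|\varphi^*\|$ we denote the norm of the composition operator $\varphi^*:L^1_p(\widetilde\Omega,w)\to L^1_s(\Omega)$, $\varphi^*f=f\circ\varphi$, with $\|\varphi^*\|=\infty$ if it is not a bounded operator between these spaces. Theorem. Let $n$, $\gamma_1,\dots,\gamma_{n-1}$ be as above and let $\alpha,a\in\mathbb R$. There is a constant $c_a>0$, depending only on $n,\gamma_1,\dots,\gamma_{n-1},\alpha$ and $a$, such that the following holds for every $p$ with $1<p<\alpha+\gamma$, $-n<\alpha<n(p-1)$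 and $$\max\Big\{0,\frac{n-p}{\alpha+\gamma-p}\Big\}<a<\frac{p(n-1)}{\alpha+\gamma-p}.$$ The domain $\Omega_n$ is a bounded convex Lipschitz domain, $\Omega_\gamma$ is bounded, and $\varphi_a$ has the Luzin $N$-property. Moreover, for every $s$ with $1<s<\dfrac{np}{a(\alpha+\gamma-p)+p}$, the map $\varphi_a$ is an $|x|^\alpha$-weighted $(p,s)$-quasiconformal homeomorphism of $\Omega_n$ onto $\Omega_\gamma$ (in particular $s<p$), and, for the weight $w=|x|^\alpha$, $$\|\varphi_a^*\|\le K_{p,s}(\varphi_a;\Omega_n)\le\frac{\sqrt{\sum_{i=1}^{n-1}(a\gamma_i-1)^2+n-1+a^2}}{\sqrt[p]{a\,c_a}}\left(\frac{p-s}{np-s\,(a(\alpha+\gamma-p)+p)}\right)^{\frac{p-s}{ps}} .$$ -/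

import Mathlib

open MeasureTheory Set Metric
open scoped ENNReal NNReal ContDiff RealInnerProductSpace

noncomputable section

section WeakDerivatives

variable {E F : Type*} [NormedAddCommGroup E] [InnerProductSpace ℝ E] [FiniteDimensional ℝ E]
  [MeasurableSpace E] [BorelSpace E] [NormedAddCommGroup F] [NormedSpace ℝ F]

/-- `Df` is a weak (distributional) derivative of `f` on the open set `Ω`: both are locally
integrable on `Ω`, and `∫_Ω (∂_v ψ) f = - ∫_Ω ψ (Df v)` for all test functions `ψ ∈ C_c^∞(Ω)` and
all directions `v`.  For real valued `f`, `‖Df x‖` is the Euclidean norm of the weak gradient. -/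
structure HasWeakFDerivOn (Ω : Set E) (f : E → F) (Df : E → E →L[ℝ] F) : Prop where
  locallyIntegrableOn : LocallyIntegrableOn f Ω volume
  locallyIntegrableOn_deriv : LocallyIntegrableOn Df Ω volume
  integral_eq : ∀ ψ : E → ℝ, ContDiff ℝ ∞ ψ → HasCompactSupport ψ → tsupport ψ ⊆ Ω → ∀ v : E,
    ∫ x in Ω, (fderiv ℝ ψ x v) • f x = - ∫ x in Ω, ψ x • (Df x v)

/-- `f` is locally integrable and weakly differentiable on `Ω`, with locally integrable weak
derivative; for open `Ω` this is `f ∈ W^1_{1,loc}(Ω)`. -/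
def WeaklyDifferentiableOn (Ω : Set E) (f : E → F) : Prop :=
  ∃ Df : E → E →L[ℝ] F, HasWeakFDerivOn Ω f Df

open Classical in
/-- A weak derivative of `f` on `Ω` (unique almost everywhere on an open set `Ω`); by convention `0`
if `f` is not weakly differentiable. -/
def weakFDeriv (Ω : Set E) (f : E → F) : E → E →L[ℝ] F :=
  if h : WeaklyDifferentiableOn Ω f then h.choose else 0

/-- The seminorm `(∫_Ω |∇f|^p w dx)^{1/p}` of `L^1_p(Ω, w)`. -/
def sobolevSeminorm (p : ℝ) (Ω : Set E) (w : E → ℝ≥0) (f : E → ℝ) : ℝ≥0∞ :=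
  (∫⁻ x in Ω, ‖weakFDeriv Ω f x‖ₑ ^ p * (w x : ℝ≥0∞)) ^ (1 / p)

/-- `f ∈ L^1_p(Ω, w)`: `f` is locally integrable and weakly differentiable on `Ω`, with finite
seminorm. -/
def MemSobolev (p : ℝ) (Ω : Set E) (w : E → ℝ≥0) (f : E → ℝ) : Prop :=
  WeaklyDifferentiableOn Ω f ∧ sobolevSeminorm p Ω w f < ⊤

/-- The norm of the composition operator `φ^* : L^1_p(Ω', w) → L^1_s(Ω)`, `φ^* f = f ∘ φ`: the least
`C` such that every `f ∈ L^1_p(Ω', w)` satisfies `f ∘ φ ∈ L^1_s(Ω)` and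
`‖f ∘ φ‖_{L^1_s(Ω)} ≤ C ‖f‖_{L^1_p(Ω', w)}`.  It is `⊤` if `φ^*` is not a bounded operator between
these spaces (in particular if it does not map the first into the second). -/
def compositionNorm (p s : ℝ) (Ω Ω' : Set E) (w : E → ℝ≥0) (φ : E → E) : ℝ≥0∞ :=
  sInf {C : ℝ≥0∞ | ∀ f : E → ℝ, MemSobolev p Ω' w f →
    MemSobolev s Ω (fun _ => 1) (f ∘ φ) ∧
      sobolevSeminorm s Ω (fun _ => 1) (f ∘ φ) ≤ C * sobolevSeminorm p Ω' w f}

/-- The quantity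
`K_{p,s}(φ; Ω) = (∫_Ω (|Dφ(x)|^p / (|J(x, φ)| w(φ(x))))^{s/(p-s)} dx)^{(p-s)/(ps)}`,
with `|Dφ(x)|` the operator norm and `J(x, φ) = det Dφ(x)`.  The quotient is taken in `[0, ∞]`, with
`0 / 0 = 0` and `c / 0 = ∞` for `c > 0`. -/
def distortionNorm (p s : ℝ) (Ω : Set E) (w : E → ℝ≥0) (φ : E → E) : ℝ≥0∞ :=
  (∫⁻ x in Ω, (‖weakFDeriv Ω φ x‖ₑ ^ p /
    (‖(weakFDeriv Ω φ x).det‖ₑ * (w (φ x) : ℝ≥0∞))) ^ (s / (p - s))) ^ ((p - s) / (p * s))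

/-- `φ` is a mapping of finite `w`-weighted distortion on `Ω`: it is of class `W^1_{1,loc}(Ω)` and
`Dφ = 0` almost everywhere on the set where `|J(x, φ)| w(φ(x)) = 0`. -/
def FiniteWeightedDistortion (Ω : Set E) (w : E → ℝ≥0) (φ : E → E) : Prop :=
  WeaklyDifferentiableOn Ω φ ∧
    ∀ᵐ x ∂(volume.restrict Ω),
      |(weakFDeriv Ω φ x).det| * (w (φ x) : ℝ) = 0 → weakFDeriv Ω φ x = 0

/-- `Ω` is a domain: a nonempty connected open set. -/
def IsDomainSet (Ω : Set E) : Prop := IsOpen Ω ∧ IsConnected Ω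

/-- `φ` is a `w`-weighted `(p, s)`-quasiconformal homeomorphism of the domain `Ω` onto the domain
`Ω'`, `1 < s < p < ∞`. -/
structure IsWeightedQuasiconformal (p s : ℝ) (w : E → ℝ≥0) (Ω Ω' : Set E) (φ : E → E) : Prop where
  one_lt : 1 < s
  lt : s < p
  isDomain_source : IsDomainSet Ω
  isDomain_target : IsDomainSet Ω'
  homeomorph : ∃ h : Ω ≃ₜ Ω', ∀ x : Ω, (h x : E) = φ x
  finiteWeightedDistortion : FiniteWeightedDistortion Ω w φ
  distortionNorm_lt_top : distortionNorm p s Ω w φ < ⊤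

/-- The Luzin `N`-property on `Ω`. -/
def LuzinN (Ω : Set E) (φ : E → E) : Prop :=
  ∀ A : Set E, A ⊆ Ω → volume A = 0 → volume (φ '' A) = 0

/-- `Ω` is a bounded Lipschitz domain: near each boundary point, with respect to some unit vector
`ν`, it is the strict epigraph of a Lipschitz function `h` of the projection
`y - ⟪ν, y⟫ ν` of `y` to the hyperplane orthogonal to `ν`. -/
def IsLipschitzDomain (Ω : Set E) : Prop :=
  IsDomainSet Ω ∧ Bornology.IsBounded Ω ∧
    ∀ x ∈ frontier Ω, ∃ ν : E, ‖ν‖ = 1 ∧ ∃ (L : ℝ≥0) (h : E → ℝ), LipschitzWith L h ∧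
      ∃ r : ℝ, 0 < r ∧ ∀ y ∈ ball x r, (y ∈ Ω ↔ h (y - ⟪ν, y⟫ • ν) < ⟪ν, y⟫)

/-- The power weight `|x|^α`. -/
def powerWeight (α : ℝ) (x : E) : ℝ≥0 := ‖x‖₊ ^ α

end WeakDerivatives

/-- The outward cuspidal domain `Ω_γ` in `ℝ^n`, `n = m + 1`: the points with `0 < x_n < 1` and
`0 < x_i < x_n ^ γ_i` for `i = 1, …, n - 1`. -/
def cuspDomain {m : ℕ} (γ : Fin m → ℝ) : Set (EuclideanSpace ℝ (Fin (m + 1))) :=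
  {x | (0 < x (Fin.last m) ∧ x (Fin.last m) < 1) ∧
    ∀ i : Fin m, 0 < x i.castSucc ∧ x i.castSucc < x (Fin.last m) ^ γ i}

/-- The domain `Ω_n` in `ℝ^n`, `n = m + 1`: the case `γ_1 = … = γ_{n-1} = 1` of `Ω_γ`. -/
def baseDomain (m : ℕ) : Set (EuclideanSpace ℝ (Fin (m + 1))) :=
  cuspDomain (fun _ : Fin m => 1)

/-- The number `γ = 1 + γ_1 + … + γ_{n-1}`, that is, `log (g_1 ⋯ g_{n-1}) / log t + 1` with
`g_i(t) = t ^ γ_i`. -/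
def cuspExponent {m : ℕ} (γ : Fin m → ℝ) : ℝ := 1 + ∑ i, γ i

/-- The map
`φ_a(x) = ((x_1 / x_n) g_1(x_n)^a, …, (x_{n-1} / x_n) g_{n-1}(x_n)^a, x_n^a)`, `g_i(t) = t ^ γ_i`. -/
def cuspMap {m : ℕ} (γ : Fin m → ℝ) (a : ℝ) (x : EuclideanSpace ℝ (Fin (m + 1))) :
    EuclideanSpace ℝ (Fin (m + 1)) :=
  WithLp.toLp 2 (Fin.snoc (α := fun _ => ℝ)
    (fun i : Fin m => x i.castSucc / x (Fin.last m) * (x (Fin.last m) ^ γ i) ^ a)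
    (x (Fin.last m) ^ a))

end

/-! The map `cuspMap γ a` is a smooth diffeomorphism of the open simplex-like cone `baseDomain m`
onto `cuspDomain γ`, so the proof splits into a general bound for smooth diffeomorphisms and an
explicit computation.

General part. For a diffeomorphism `φ` with inverse `η`, weak derivatives obey the chain rule
(`hasWeakFDerivOn_comp`): a test function on the source is pushed forward to a compactly supported
vector field on the target (`piola`), whose divergence is given by the Piola identity. Then `|D(f ∘
φ)|^s ≤ A^(s/p) G^(s/p)`, where `A = |J| (|Df|^p w) ∘ φ` integrates to the weighted energy of `f`
and `G` is the distortion quotient. Hölder with exponents `p/s` and `p/(p-s)` gives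
`sobolevSeminorm_comp_le`, hence the operator norm is at most `K_{p,s}`.

Explicit part. Write `t = x_n`. The Jacobian matrix is triangular with determinant `a t^(aγ-n)`, its
norm is at most `C t^(a-1)`, and `|φ_a(x)|^α ≥ c t^(aα)` because `|y|` is comparable to `y_n` on the
cusp. The distortion quotient is therefore at most a constant times a power of `t`
(`distortion_quotient_le`). Slicing `baseDomain m` into cubes of side `t` integrates that power
exactly (`lintegral_baseDomain_rpow`); convergence is precisely the upper bound on `s`. -/

/-! ### Weak derivatives: existence, uniqueness, testing against vector fields -/

section WeakDerivativeTheory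

variable {E F : Type*} [NormedAddCommGroup E] [InnerProductSpace ℝ E] [FiniteDimensional ℝ E]

/-- The divergence of a vector field. -/
noncomputable def vectorDiv (T : E → E) (x : E) : ℝ :=
  ∑ i, ⟪stdOrthonormalBasis ℝ E i, fderiv ℝ T x (stdOrthonormalBasis ℝ E i)⟫

theorem ContDiff.continuous_vectorDiv {T : E → E} (hT : ContDiff ℝ ∞ T) :
    Continuous (vectorDiv T) :=
  continuous_finsetSum _ fun i _ => continuous_const.inner
    ((hT.continuous_fderiv (by simp)).clm_apply continuous_const)

variable [MeasurableSpace E] [BorelSpace E] [NormedAddCommGroup F] [NormedSpace ℝ F]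

theorem MeasureTheory.LocallyIntegrableOn.integrable_smul_of_tsupport_subset {Ω : Set E}
    {f : E → F} (hf : LocallyIntegrableOn f Ω volume) {g : E → ℝ} (hg : Continuous g)
    (hc : HasCompactSupport g) (hs : tsupport g ⊆ Ω) : Integrable (fun x => g x • f x) := by
  have hK : IsCompact (tsupport g) := hc
  have h1 : IntegrableOn (fun x => g x • f x) (tsupport g) :=
    (hf.integrableOn_compact_subset hs hK).continuousOn_smul hg.continuousOn hK
  refine (integrableOn_iff_integrable_of_support_subset ?_).1 h1
  intro x hx
  refine subset_tsupport g ?_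
  intro h0
  exact hx (by simp [h0])

/-- Integration by parts on the whole space suffices: all products with `ψ` vanish off `Ω`, and `f`
need only be differentiable on `tsupport ψ`. -/
theorem ContDiffOn.hasWeakFDerivOn {Ω : Set E} (hΩ : IsOpen Ω) {f : E → F}
    (hf : ContDiffOn ℝ 1 f Ω) : HasWeakFDerivOn Ω f (fderiv ℝ f) := by
  have hl : LocallyIntegrableOn f Ω volume :=
    hf.continuousOn.locallyIntegrableOn hΩ.measurableSet
  have hl' : LocallyIntegrableOn (fderiv ℝ f) Ω volume :=
    (hf.continuousOn_fderiv_of_isOpen hΩ le_rfl).locallyIntegrableOn hΩ.measurableSet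
  refine ⟨hl, hl', fun ψ hψ hc hs v => ?_⟩
  have hl'' : LocallyIntegrableOn (fun x => fderiv ℝ f x v) Ω volume :=
    ((hf.continuousOn_fderiv_of_isOpen hΩ le_rfl).clm_apply
      continuousOn_const).locallyIntegrableOn hΩ.measurableSet
  have hψ' : Continuous fun x => fderiv ℝ ψ x v :=
    (hψ.continuous_fderiv (by simp)).clm_apply continuous_const
  have hts : tsupport (fun x => fderiv ℝ ψ x v) ⊆ tsupport ψ := by
    refine closure_minimal (fun x hx => ?_) (isClosed_tsupport ψ)
    by_contra h
    exact hx (by simp [fderiv_of_notMem_tsupport (𝕜 := ℝ) h])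
  have hc' : HasCompactSupport fun x => fderiv ℝ ψ x v :=
    HasCompactSupport.of_support_subset_isCompact hc ((subset_tsupport _).trans hts)
  have key := integral_smul_fderiv_eq_neg_fderiv_smul_of_integrable (μ := volume) (v := v)
    (hl.integrable_smul_of_tsupport_subset hψ' hc' (hts.trans hs))
    (hl''.integrable_smul_of_tsupport_subset hψ.continuous hc hs)
    (hl.integrable_smul_of_tsupport_subset hψ.continuous hc hs)
    (fun x _ => (hψ.differentiable (by simp)) x)
    (fun x hx => (hf.contDiffAt (hΩ.mem_nhds (hs hx))).differentiableAt (by simp))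
  rw [setIntegral_eq_integral_of_forall_compl_eq_zero,
    setIntegral_eq_integral_of_forall_compl_eq_zero, key, neg_neg]
  · intro x hx
    simp [image_eq_zero_of_notMem_tsupport fun h => hx (hs h)]
  · intro x hx
    simp [fderiv_of_notMem_tsupport (𝕜 := ℝ) fun h => hx (hs h)]

theorem MeasureTheory.LocallyIntegrableOn.clm_apply_const {Ω : Set E} (hΩ : IsOpen Ω)
    {D : E → E →L[ℝ] F}
    (hD : LocallyIntegrableOn D Ω volume) (v : E) :
    LocallyIntegrableOn (fun x => D x v) Ω volume := by
  rw [locallyIntegrableOn_iff hΩ.isLocallyClosed] at hD ⊢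
  exact fun k hk hk' => (hD k hk hk').apply_continuousLinearMap v

/-- The fundamental lemma of the calculus of variations, applied to each vector of a basis. It makes
the arbitrary choice in `weakFDeriv` harmless. -/
theorem HasWeakFDerivOn.ae_eq [CompleteSpace F] {Ω : Set E} (hΩ : IsOpen Ω) {f : E → F}
    {D₁ D₂ : E → E →L[ℝ] F} (h₁ : HasWeakFDerivOn Ω f D₁) (h₂ : HasWeakFDerivOn Ω f D₂) :
    D₁ =ᵐ[volume.restrict Ω] D₂ := by
  have key : ∀ v : E, ∀ᵐ x, x ∈ Ω → D₁ x v - D₂ x v = 0 := by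
    intro v
    have l₁ := h₁.locallyIntegrableOn_deriv.clm_apply_const hΩ v
    have l₂ := h₂.locallyIntegrableOn_deriv.clm_apply_const hΩ v
    refine hΩ.ae_eq_zero_of_integral_contDiff_smul_eq_zero (l₁.sub l₂) fun ψ hψ hc hs => ?_
    have e₁ := h₁.integral_eq ψ hψ hc hs v
    have e₂ := h₂.integral_eq ψ hψ hc hs v
    have e : ∀ D : E → E →L[ℝ] F, ∫ x in Ω, ψ x • D x v = ∫ x, ψ x • D x v := fun D =>
      setIntegral_eq_integral_of_forall_compl_eq_zero fun x hx => by
        simp [image_eq_zero_of_notMem_tsupport fun h => hx (hs h)]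
    rw [e] at e₁ e₂
    simp only [smul_sub]
    rw [integral_sub (l₁.integrable_smul_of_tsupport_subset hψ.continuous hc hs)
      (l₂.integrable_smul_of_tsupport_subset hψ.continuous hc hs), sub_eq_zero]
    exact neg_injective (e₁.symm.trans e₂)
  let b := stdOrthonormalBasis ℝ E
  have hall : ∀ᵐ x, ∀ i, x ∈ Ω → D₁ x (b i) - D₂ x (b i) = 0 := ae_all_iff.2 fun i => key (b i)
  rw [Filter.EventuallyEq, ae_restrict_iff' hΩ.measurableSet]
  filter_upwards [hall] with x hx hxΩ
  have : (D₁ x : E →ₗ[ℝ] F) = D₂ x :=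
    b.toBasis.ext fun i => by simpa using sub_eq_zero.1 (hx i hxΩ)
  exact ContinuousLinearMap.coe_injective this

theorem WeaklyDifferentiableOn.hasWeakFDerivOn {Ω : Set E} {f : E → F}
    (h : WeaklyDifferentiableOn Ω f) : HasWeakFDerivOn Ω f (weakFDeriv Ω f) := by
  rw [weakFDeriv, dif_pos h]
  exact h.choose_spec

theorem HasWeakFDerivOn.weakFDeriv_ae_eq [CompleteSpace F] {Ω : Set E} (hΩ : IsOpen Ω) {f : E → F}
    {D : E → E →L[ℝ] F} (h : HasWeakFDerivOn Ω f D) :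
    weakFDeriv Ω f =ᵐ[volume.restrict Ω] D :=
  HasWeakFDerivOn.ae_eq hΩ (WeaklyDifferentiableOn.hasWeakFDerivOn ⟨D, h⟩) h

/-- Expand `T` in an orthonormal basis and sum the scalar identities, each coordinate of `T` being a
test function. -/
theorem HasWeakFDerivOn.integral_vectorDiv {Ω : Set E} (hΩ : IsOpen Ω) {f : E → F}
    {D : E → E →L[ℝ] F} (h : HasWeakFDerivOn Ω f D) {T : E → E} (hT : ContDiff ℝ ∞ T)
    (hc : HasCompactSupport T) (hs : tsupport T ⊆ Ω) :
    ∫ x in Ω, vectorDiv T x • f x = - ∫ x in Ω, D x (T x) := by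
  let b := stdOrthonormalBasis ℝ E
  let ψ : Fin (Module.finrank ℝ E) → E → ℝ := fun i x => ⟪b i, T x⟫
  have hψ : ∀ i, ContDiff ℝ ∞ (ψ i) := fun i => contDiff_const.inner ℝ hT
  have hts : ∀ i, tsupport (ψ i) ⊆ tsupport T := fun i =>
    closure_mono fun x hx h0 => hx (by simp [ψ, h0])
  have hcs : ∀ i, HasCompactSupport (ψ i) := fun i =>
    HasCompactSupport.of_support_subset_isCompact hc ((subset_tsupport _).trans (hts i))
  have hfd : ∀ i x, fderiv ℝ (ψ i) x (b i) = ⟪b i, fderiv ℝ T x (b i)⟫ := by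
    intro i x
    have h1 : HasFDerivAt (ψ i) ((innerSL ℝ (b i)).comp (fderiv ℝ T x)) x :=
      (innerSL ℝ (b i)).hasFDerivAt.comp x ((hT.differentiable (by simp)) x).hasFDerivAt
    rw [h1.fderiv]; rfl
  have hts' : ∀ i, tsupport (fun x => fderiv ℝ (ψ i) x (b i)) ⊆ tsupport T := by
    refine fun i => closure_minimal (fun x hx => ?_) (isClosed_tsupport T)
    by_contra h
    exact hx (by simp [fderiv_of_notMem_tsupport (𝕜 := ℝ) fun h' => h (hts i h')])
  have i1 : ∀ i ∈ Finset.univ, Integrable (fun x => fderiv ℝ (ψ i) x (b i) • f x)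
      (volume.restrict Ω) := fun i _ =>
    (h.locallyIntegrableOn.integrable_smul_of_tsupport_subset
      (((hψ i).continuous_fderiv (by simp)).clm_apply continuous_const)
      (HasCompactSupport.of_support_subset_isCompact hc ((subset_tsupport _).trans (hts' i)))
      ((hts' i).trans hs)).integrableOn
  have i2 : ∀ i ∈ Finset.univ, Integrable (fun x => ψ i x • D x (b i))
      (volume.restrict Ω) := fun i _ =>
    ((h.locallyIntegrableOn_deriv.clm_apply_const hΩ (b i)).integrable_smul_of_tsupport_subset
      (hψ i).continuous (hcs i) ((hts i).trans hs)).integrableOn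
  have e1 : ∀ x, vectorDiv T x • f x = ∑ i, fderiv ℝ (ψ i) x (b i) • f x := by
    intro x
    rw [vectorDiv, Finset.sum_smul]
    exact Finset.sum_congr rfl fun i _ => by rw [hfd]
  have e2 : ∀ x, D x (T x) = ∑ i, ψ i x • D x (b i) := by
    intro x
    conv_lhs => rw [← b.sum_repr' (T x)]
    simp [ψ]
  simp_rw [e1, e2]
  rw [integral_finsetSum _ i1, integral_finsetSum _ i2, ← Finset.sum_neg_distrib]
  exact Finset.sum_congr rfl fun i _ => h.integral_eq (ψ i) (hψ i) (hcs i) ((hts i).trans hs) (b i)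

end WeakDerivativeTheory

/-! ### Smooth diffeomorphisms, the Piola identity and the weak chain rule -/

section ChangeOfVariables

variable {E : Type*} [NormedAddCommGroup E] [InnerProductSpace ℝ E]

/-- `φ` maps the open set `Ω` smoothly onto the open set `Ω'`, with smooth inverse `η`. -/
structure SmoothDiffeoOn (φ η : E → E) (Ω Ω' : Set E) : Prop where
  isOpen_source : IsOpen Ω
  isOpen_target : IsOpen Ω'
  contDiffOn : ContDiffOn ℝ ∞ φ Ω
  contDiffOn_inv : ContDiffOn ℝ ∞ η Ω'
  mapsTo : MapsTo φ Ω Ω'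
  mapsTo_inv : MapsTo η Ω' Ω
  leftInvOn : LeftInvOn η φ Ω
  rightInvOn : RightInvOn η φ Ω'

/-- By the Leibniz formula the determinant is a polynomial in the matrix entries. This is needed for
the smoothness of `piola`. -/
theorem contDiff_clm_det [FiniteDimensional ℝ E] : ContDiff ℝ ∞ fun A : E →L[ℝ] E => A.det := by
  let b := (stdOrthonormalBasis ℝ E).toBasis
  have h : (fun A : E →L[ℝ] E => A.det) =
      fun A => ∑ σ : Equiv.Perm (Fin (Module.finrank ℝ E)),
        Equiv.Perm.sign σ •
          ∏ i, ⟪stdOrthonormalBasis ℝ E (σ i), A (stdOrthonormalBasis ℝ E i)⟫ := by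
    ext A
    rw [ContinuousLinearMap.det, ← LinearMap.det_toMatrix b, Matrix.det_apply]
    simp [b, LinearMap.toMatrix_apply, OrthonormalBasis.repr_apply_apply]
  rw [h]
  refine ContDiff.sum fun σ _ => ContDiff.const_smul _ (contDiff_prod fun i _ => ?_)
  exact contDiff_const.inner ℝ (contDiff_id.clm_apply contDiff_const)

namespace SmoothDiffeoOn

variable {φ η : E → E} {Ω Ω' : Set E} {ψ : E → ℝ}

theorem injOn (h : SmoothDiffeoOn φ η Ω Ω') : InjOn φ Ω := h.leftInvOn.injOn

theorem image_eq (h : SmoothDiffeoOn φ η Ω Ω') : φ '' Ω = Ω' :=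
  h.mapsTo.image_subset.antisymm fun y hy => ⟨η y, h.mapsTo_inv hy, h.rightInvOn hy⟩

theorem hasFDerivAt (h : SmoothDiffeoOn φ η Ω Ω') {x : E} (hx : x ∈ Ω) :
    HasFDerivAt φ (fderiv ℝ φ x) x :=
  ((h.contDiffOn.contDiffAt (h.isOpen_source.mem_nhds hx)).differentiableAt (by simp)).hasFDerivAt

theorem symm (h : SmoothDiffeoOn φ η Ω Ω') : SmoothDiffeoOn η φ Ω' Ω :=
  ⟨h.isOpen_target, h.isOpen_source, h.contDiffOn_inv, h.contDiffOn, h.mapsTo_inv, h.mapsTo,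
    h.rightInvOn, h.leftInvOn⟩

/-- Differentiating `η ∘ φ = id` makes the product of the two determinants equal to one. -/
theorem det_ne_zero (h : SmoothDiffeoOn φ η Ω Ω') {x : E} (hx : x ∈ Ω) :
    (fderiv ℝ φ x).det ≠ 0 := by
  have h1 : HasFDerivAt (η ∘ φ) ((fderiv ℝ η (φ x)).comp (fderiv ℝ φ x)) x :=
    (h.symm.hasFDerivAt (h.mapsTo hx)).comp x (h.hasFDerivAt hx)
  have h2 : HasFDerivAt (η ∘ φ) (ContinuousLinearMap.id ℝ E) x :=
    (hasFDerivAt_id x).congr_of_eventuallyEq <|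
      Filter.eventually_of_mem (h.isOpen_source.mem_nhds hx) h.leftInvOn
  have h3 := congrArg (fun A : E →L[ℝ] E => LinearMap.det (A : E →ₗ[ℝ] E)) (h1.unique h2)
  simp only [ContinuousLinearMap.toLinearMap_comp, LinearMap.det_comp,
    ContinuousLinearMap.coe_id, LinearMap.det_id] at h3
  exact right_ne_zero_of_mul_eq_one h3

theorem continuousOn_fderiv (h : SmoothDiffeoOn φ η Ω Ω') : ContinuousOn (fderiv ℝ φ) Ω :=
  h.contDiffOn.continuousOn_fderiv_of_isOpen h.isOpen_source (by simp)

/-- The homeomorphism given by a smooth diffeomorphism. -/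
def toHomeomorph (h : SmoothDiffeoOn φ η Ω Ω') : Ω ≃ₜ Ω' where
  toFun x := ⟨φ x, h.mapsTo x.2⟩
  invFun y := ⟨η y, h.mapsTo_inv y.2⟩
  left_inv x := Subtype.ext (h.leftInvOn x.2)
  right_inv y := Subtype.ext (h.rightInvOn y.2)
  continuous_toFun := h.contDiffOn.continuousOn.mapsToRestrict h.mapsTo
  continuous_invFun := h.contDiffOn_inv.continuousOn.mapsToRestrict h.mapsTo_inv

/-- The transport to `Ω'` of the vector field `ψ v` on `Ω`, as a vector valued density. -/
noncomputable def piola (φ η : E → E) (Ω' : Set E) (ψ : E → ℝ) (v : E) : E → E :=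
  Ω'.indicator fun y =>
    (ψ (η y) * |(fderiv ℝ φ (η y)).det|⁻¹) • fderiv ℝ φ (η y) v

theorem piola_apply (h : SmoothDiffeoOn φ η Ω Ω') (v : E) {x : E} (hx : x ∈ Ω) :
    piola φ η Ω' ψ v (φ x) = (ψ x * |(fderiv ℝ φ x).det|⁻¹) • fderiv ℝ φ x v := by
  rw [piola, indicator_of_mem (h.mapsTo hx), h.leftInvOn hx]

theorem isCompact_image_tsupport (h : SmoothDiffeoOn φ η Ω Ω') (hc : HasCompactSupport ψ)
    (hs : tsupport ψ ⊆ Ω) : IsCompact (φ '' tsupport ψ) :=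
  IsCompact.image_of_continuousOn hc (h.contDiffOn.continuousOn.mono hs)

theorem support_piola (h : SmoothDiffeoOn φ η Ω Ω') (v : E) :
    Function.support (piola φ η Ω' ψ v) ⊆ φ '' tsupport ψ := by
  intro y hy
  have hyΩ : y ∈ Ω' := by
    by_contra hn
    exact hy (indicator_of_notMem hn _)
  refine ⟨η y, ?_, h.rightInvOn hyΩ⟩
  by_contra hn
  exact hy (by simp [piola, image_eq_zero_of_notMem_tsupport hn])

theorem tsupport_piola (h : SmoothDiffeoOn φ η Ω Ω') (hc : HasCompactSupport ψ)
    (hs : tsupport ψ ⊆ Ω) (v : E) : tsupport (piola φ η Ω' ψ v) ⊆ φ '' tsupport ψ :=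
  closure_minimal (h.support_piola v) (h.isCompact_image_tsupport hc hs).isClosed

theorem continuousOn_abs_det (h : SmoothDiffeoOn φ η Ω Ω') :
    ContinuousOn (fun x => |(fderiv ℝ φ x).det|) Ω :=
  (ContinuousLinearMap.continuous_det.comp_continuousOn h.continuousOn_fderiv).abs

theorem continuousOn_inv_abs_det (h : SmoothDiffeoOn φ η Ω Ω') :
    ContinuousOn (fun x => |(fderiv ℝ φ x).det|⁻¹) Ω :=
  h.continuousOn_abs_det.inv₀ fun _ hx => abs_ne_zero.2 (h.det_ne_zero hx)

variable [FiniteDimensional ℝ E]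

theorem contDiff_piola (h : SmoothDiffeoOn φ η Ω Ω') (hψ : ContDiff ℝ ∞ ψ)
    (hc : HasCompactSupport ψ) (hs : tsupport ψ ⊆ Ω) (v : E) :
    ContDiff ℝ ∞ (piola φ η Ω' ψ v) := by
  rw [contDiff_iff_contDiffAt]
  intro y
  by_cases hy : y ∈ Ω'
  · have hη : ContDiffAt ℝ ∞ η y := h.contDiffOn_inv.contDiffAt (h.isOpen_target.mem_nhds hy)
    have hD : ContDiffAt ℝ ∞ (fun y => fderiv ℝ φ (η y)) y :=
      ((h.contDiffOn.contDiffAt (h.isOpen_source.mem_nhds (h.mapsTo_inv hy))).fderiv_right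
        (m := ∞) (by simp)).comp y hη
    have hdet : ContDiffAt ℝ ∞ (fun y => |(fderiv ℝ φ (η y)).det|⁻¹) y := by
      have h0 := h.det_ne_zero (h.mapsTo_inv hy)
      have h1 : ContDiffAt ℝ ∞ (fun y => (fderiv ℝ φ (η y)).det) y :=
        contDiff_clm_det.contDiffAt.comp y hD
      exact (h1.abs h0).inv (abs_ne_zero.2 h0)
    have : ContDiffAt ℝ ∞ (fun y =>
        (ψ (η y) * |(fderiv ℝ φ (η y)).det|⁻¹) • fderiv ℝ φ (η y) v) y :=
      ((hψ.contDiffAt.comp y hη).mul hdet).smul (hD.clm_apply contDiffAt_const)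
    exact this.congr_of_eventuallyEq (Filter.eventually_of_mem (h.isOpen_target.mem_nhds hy)
      fun z hz => indicator_of_mem hz _)
  -- The field lives on a compact subset of `Ω'`, so it vanishes near any point outside `Ω'`:
  -- extension by zero stays smooth.
  · have hK := (h.isCompact_image_tsupport hc hs).isClosed
    have hyK : y ∉ φ '' tsupport ψ := fun hn => hy ((h.mapsTo.mono_left hs).image_subset hn)
    refine (contDiffAt_const (c := (0 : E))).congr_of_eventuallyEq
      (Filter.eventually_of_mem (hK.isOpen_compl.mem_nhds hyK) fun z hz => ?_)
    by_contra hn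
    exact hz (h.support_piola v hn)

variable {F : Type*} [MeasurableSpace E] [BorelSpace E] [NormedAddCommGroup F] [NormedSpace ℝ F]

theorem integral_eq (h : SmoothDiffeoOn φ η Ω Ω') (g : E → F) :
    ∫ y in Ω', g y = ∫ x in Ω, |(fderiv ℝ φ x).det| • g (φ x) := by
  rw [← h.image_eq]
  exact integral_image_eq_integral_abs_det_fderiv_smul volume h.isOpen_source.measurableSet
    (fun x hx => (h.hasFDerivAt hx).hasFDerivWithinAt) h.injOn g

theorem lintegral_eq (h : SmoothDiffeoOn φ η Ω Ω') (g : E → ℝ≥0∞) :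
    ∫⁻ y in Ω', g y = ∫⁻ x in Ω, ‖(fderiv ℝ φ x).det‖ₑ * g (φ x) := by
  rw [← h.image_eq]
  simp_rw [Real.enorm_eq_ofReal_abs]
  exact lintegral_image_eq_lintegral_abs_det_fderiv_mul volume h.isOpen_source.measurableSet
    (fun x hx => (h.hasFDerivAt hx).hasFDerivWithinAt) h.injOn g

/-- Change of variables makes `|J| (g ∘ φ)` integrable on compact sets, and the continuous factor
`|J|⁻¹` can be removed there. -/
theorem locallyIntegrableOn_comp (h : SmoothDiffeoOn φ η Ω Ω') {g : E → F}
    (hg : LocallyIntegrableOn g Ω' volume) : LocallyIntegrableOn (g ∘ φ) Ω volume := by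
  rw [locallyIntegrableOn_iff h.isOpen_source.isLocallyClosed]
  intro K hKΩ hK
  have hφK : IsCompact (φ '' K) := hK.image_of_continuousOn (h.contDiffOn.continuousOn.mono hKΩ)
  have h1 : IntegrableOn g (φ '' K) :=
    hg.integrableOn_compact_subset (h.mapsTo.mono_left hKΩ).image_subset hφK
  rw [integrableOn_image_iff_integrableOn_abs_det_fderiv_smul volume hK.measurableSet
    (fun x hx => (h.hasFDerivAt (hKΩ hx)).hasFDerivWithinAt) (h.injOn.mono hKΩ)] at h1
  refine (h1.continuousOn_smul (h.continuousOn_inv_abs_det.mono hKΩ) hK).congr_fun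
    (fun x hx => ?_) hK.measurableSet
  exact inv_smul_smul₀ (abs_ne_zero.2 (h.det_ne_zero (hKΩ hx))) _

theorem locallyIntegrableOn_comp_fderiv (h : SmoothDiffeoOn φ η Ω Ω') {D : E → E →L[ℝ] F}
    (hD : LocallyIntegrableOn D Ω' volume) :
    LocallyIntegrableOn (fun x => (D (φ x)).comp (fderiv ℝ φ x)) Ω volume := by
  have h1 := h.locallyIntegrableOn_comp hD
  rw [locallyIntegrableOn_iff h.isOpen_source.isLocallyClosed] at h1 ⊢
  intro K hKΩ hK
  have h2 := h1 K hKΩ hK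
  have h3 : ContinuousOn (fderiv ℝ φ) K := h.continuousOn_fderiv.mono hKΩ
  obtain ⟨C, hC⟩ := hK.exists_bound_of_continuousOn h3
  refine Integrable.mono' (h2.norm.mul_const C) ?_ ?_
  · exact (ContinuousLinearMap.compL ℝ E E F).aestronglyMeasurable_comp₂ h2.aestronglyMeasurable
      (h3.aestronglyMeasurable hK.measurableSet)
  · refine (ae_restrict_iff' hK.measurableSet).2 (Filter.Eventually.of_forall fun x hx => ?_)
    exact (ContinuousLinearMap.opNorm_comp_le _ _).trans
      (mul_le_mul_of_nonneg_left (hC x hx) (norm_nonneg _))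

/-- Pulled back to `Ω`, the density factor of the field cancels the Jacobian and leaves `ψ` times
`Dφ v`. -/
theorem integral_piola (h : SmoothDiffeoOn φ η Ω Ω') (hψ : ContDiff ℝ ∞ ψ)
    (hc : HasCompactSupport ψ) (hs : tsupport ψ ⊆ Ω) (v : E) {f : E → F} {D : E → E →L[ℝ] F}
    (hf : HasWeakFDerivOn Ω' f D) :
    ∫ y in Ω', vectorDiv (piola φ η Ω' ψ v) y • f y =
      - ∫ x in Ω, ψ x • ((D (φ x)).comp (fderiv ℝ φ x)) v := by
  have hK := h.isCompact_image_tsupport hc hs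
  rw [hf.integral_vectorDiv h.isOpen_target (h.contDiff_piola hψ hc hs v)
    (HasCompactSupport.of_support_subset_isCompact hK (h.support_piola v))
    ((h.tsupport_piola hc hs v).trans (h.mapsTo.mono_left hs).image_subset), h.integral_eq]
  congr 1
  refine setIntegral_congr_fun h.isOpen_source.measurableSet fun x hx => ?_
  have h0 : |(fderiv ℝ φ x).det| ≠ 0 := abs_ne_zero.2 (h.det_ne_zero hx)
  simp only [h.piola_apply v hx, map_smul, smul_smul, ContinuousLinearMap.comp_apply]
  congr 1
  field_simp

theorem integral_comp_eq (h : SmoothDiffeoOn φ η Ω Ω') (u : E → ℝ) (f : E → F) :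
    ∫ x in Ω, u x • f (φ x) = ∫ y in Ω', (u (η y) * |(fderiv ℝ φ (η y)).det|⁻¹) • f y := by
  rw [h.integral_eq]
  refine setIntegral_congr_fun h.isOpen_source.measurableSet fun x hx => ?_
  have h0 : |(fderiv ℝ φ x).det| ≠ 0 := abs_ne_zero.2 (h.det_ne_zero hx)
  simp only [h.leftInvOn hx, smul_smul]
  congr 1
  field_simp

/-- The Piola identity. -/
theorem vectorDiv_piola (h : SmoothDiffeoOn φ η Ω Ω') (hψ : ContDiff ℝ ∞ ψ)
    (hc : HasCompactSupport ψ) (hs : tsupport ψ ⊆ Ω) (v : E) :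
    ∀ᵐ y, y ∈ Ω' →
      fderiv ℝ ψ (η y) v * |(fderiv ℝ φ (η y)).det|⁻¹ - vectorDiv (piola φ η Ω' ψ v) y = 0 := by
  have l₁ : LocallyIntegrableOn (fun y => fderiv ℝ ψ (η y) v * |(fderiv ℝ φ (η y)).det|⁻¹)
      Ω' volume := by
    refine ContinuousOn.locallyIntegrableOn (ContinuousOn.mul ?_ ?_) h.isOpen_target.measurableSet
    · exact ((hψ.continuous_fderiv (by simp)).clm_apply continuous_const).comp_continuousOn
        h.contDiffOn_inv.continuousOn
    · exact h.continuousOn_inv_abs_det.comp h.contDiffOn_inv.continuousOn h.mapsTo_inv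
  have l₂ : LocallyIntegrableOn (vectorDiv (piola φ η Ω' ψ v)) Ω' volume :=
    (h.contDiff_piola hψ hc hs v).continuous_vectorDiv.continuousOn.locallyIntegrableOn
      h.isOpen_target.measurableSet
  -- The identity is proved by duality, without second derivatives of `φ`: against a smooth `g`,
  -- both sides reduce to the integration by parts of `g ∘ φ` against `ψ` on `Ω`, where the chain
  -- rule is classical.
  refine h.isOpen_target.ae_eq_zero_of_integral_contDiff_smul_eq_zero (l₁.sub l₂)
    fun g hg hgc hgs => ?_
  have hgw : HasWeakFDerivOn Ω' g (fderiv ℝ g) :=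
    ContDiffOn.hasWeakFDerivOn h.isOpen_target (hg.contDiffOn.of_le (by simp))
  have hgφ : ContDiffOn ℝ 1 (g ∘ φ) Ω :=
    (hg.comp_contDiffOn h.contDiffOn).of_le (by simp)
  have e1 := (hgφ.hasWeakFDerivOn h.isOpen_source).integral_eq ψ hψ hc hs v
  have e2 := h.integral_piola hψ hc hs v hgw
  have e3 := h.integral_comp_eq (fun x => fderiv ℝ ψ x v) g
  have e4 : ∫ x in Ω, ψ x • fderiv ℝ (g ∘ φ) x v =
      ∫ x in Ω, ψ x • ((fderiv ℝ g (φ x)).comp (fderiv ℝ φ x)) v := by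
    refine setIntegral_congr_fun h.isOpen_source.measurableSet fun x hx => ?_
    rw [(((hg.differentiable (by simp)) (φ x)).hasFDerivAt.comp x (h.hasFDerivAt hx)).fderiv]
  have e : ∀ u : E → ℝ, ∫ x in Ω', u x • g x = ∫ x, g x • u x := fun u => by
    rw [setIntegral_eq_integral_of_forall_compl_eq_zero]
    · simp only [smul_eq_mul, mul_comm]
    · intro x hx
      simp [image_eq_zero_of_notMem_tsupport fun h => hx (hgs h)]
  rw [e] at e2 e3
  simp only [smul_sub]
  rw [integral_sub (l₁.integrable_smul_of_tsupport_subset hg.continuous hgc hgs)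
      (l₂.integrable_smul_of_tsupport_subset hg.continuous hgc hgs), sub_eq_zero, ← e3, e2, ← e4]
  exact e1

/-- The chain rule for weak derivatives under a smooth diffeomorphism. -/
theorem hasWeakFDerivOn_comp (h : SmoothDiffeoOn φ η Ω Ω') {f : E → F} {D : E → E →L[ℝ] F}
    (hf : HasWeakFDerivOn Ω' f D) :
    HasWeakFDerivOn Ω (f ∘ φ) fun x => (D (φ x)).comp (fderiv ℝ φ x) := by
  refine ⟨h.locallyIntegrableOn_comp hf.locallyIntegrableOn,
    h.locallyIntegrableOn_comp_fderiv hf.locallyIntegrableOn_deriv, fun ψ hψ hc hs v => ?_⟩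
  rw [← h.integral_piola hψ hc hs v hf]
  simp only [Function.comp_apply]
  rw [h.integral_comp_eq (fun x => fderiv ℝ ψ x v) f]
  refine setIntegral_congr_ae h.isOpen_target.measurableSet ?_
  filter_upwards [h.vectorDiv_piola hψ hc hs v] with y hy hyΩ
  rw [sub_eq_zero.1 (hy hyΩ)]

theorem weakFDeriv_ae_eq (h : SmoothDiffeoOn φ η Ω Ω') :
    weakFDeriv Ω φ =ᵐ[volume.restrict Ω] fderiv ℝ φ :=
  ((h.contDiffOn.of_le (by simp)).hasWeakFDerivOn h.isOpen_source).weakFDeriv_ae_eq h.isOpen_source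

theorem distortionNorm_eq (h : SmoothDiffeoOn φ η Ω Ω') (p s : ℝ) (w : E → ℝ≥0) :
    distortionNorm p s Ω w φ =
      (∫⁻ x in Ω, (‖fderiv ℝ φ x‖ₑ ^ p / (‖(fderiv ℝ φ x).det‖ₑ * (w (φ x) : ℝ≥0∞))) ^
        (s / (p - s))) ^ ((p - s) / (p * s)) := by
  rw [distortionNorm]
  congr 1
  refine lintegral_congr_ae ?_
  filter_upwards [h.weakFDeriv_ae_eq] with x hx
  rw [hx]

/-- The degeneracy condition is vacuous: neither the Jacobian nor the weight vanishes. -/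
theorem finiteWeightedDistortion (h : SmoothDiffeoOn φ η Ω Ω') {w : E → ℝ≥0}
    (hw : ∀ y ∈ Ω', w y ≠ 0) : FiniteWeightedDistortion Ω w φ := by
  refine ⟨⟨_, (h.contDiffOn.of_le (by simp)).hasWeakFDerivOn h.isOpen_source⟩, ?_⟩
  filter_upwards [h.weakFDeriv_ae_eq, ae_restrict_mem h.isOpen_source.measurableSet]
    with x hx hxΩ h0
  rw [hx] at h0
  have := h.det_ne_zero hxΩ
  have := hw _ (h.mapsTo hxΩ)
  simp_all

theorem luzinN (h : SmoothDiffeoOn φ η Ω Ω') : LuzinN Ω φ := fun _ hA hA0 =>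
  addHaar_image_eq_zero_of_differentiableOn_of_addHaar_eq_zero volume
    (fun _ hx => (h.hasFDerivAt (hA hx)).differentiableAt.differentiableWithinAt) hA0

end SmoothDiffeoOn

end ChangeOfVariables

/-! ### The composition operator is bounded by the distortion norm -/

section CompositionOperator

variable {E : Type*} [NormedAddCommGroup E] [InnerProductSpace ℝ E] [FiniteDimensional ℝ E]
  [MeasurableSpace E] [BorelSpace E]

namespace SmoothDiffeoOn

variable {φ η : E → E} {Ω Ω' : Set E}

/-- Multiply and divide by `|J| w ∘ φ`, apply Hölder, and change variables in the factor that
contains `f`. -/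
theorem sobolevSeminorm_comp_le (h : SmoothDiffeoOn φ η Ω Ω') {p s : ℝ} (hs : 0 < s) (hsp : s < p)
    {w : E → ℝ≥0} (hw : Measurable w) (hw0 : ∀ y ∈ Ω', w y ≠ 0) {f : E → ℝ}
    (hf : WeaklyDifferentiableOn Ω' f) :
    sobolevSeminorm s Ω (fun _ => 1) (f ∘ φ) ≤
      distortionNorm p s Ω w φ * sobolevSeminorm p Ω' w f := by
  have hp : 0 < p := hs.trans hsp
  have hps : 0 < p - s := sub_pos.2 hsp
  have hΩ := h.isOpen_source.measurableSet
  set D := weakFDeriv Ω' f with hD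
  have hfD := hf.hasWeakFDerivOn
  rw [h.distortionNorm_eq, sobolevSeminorm, sobolevSeminorm, h.lintegral_eq]
  set A : E → ℝ≥0∞ := fun x => ‖(fderiv ℝ φ x).det‖ₑ * (‖D (φ x)‖ₑ ^ p * (w (φ x) : ℝ≥0∞))
  set G : E → ℝ≥0∞ := fun x =>
    ‖fderiv ℝ φ x‖ₑ ^ p / (‖(fderiv ℝ φ x).det‖ₑ * (w (φ x) : ℝ≥0∞))
  have mdet : AEMeasurable (fun x => ‖(fderiv ℝ φ x).det‖ₑ) (volume.restrict Ω) :=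
    ((ContinuousLinearMap.continuous_det.comp_continuousOn
      h.continuousOn_fderiv).aestronglyMeasurable hΩ).enorm
  have mw : AEMeasurable (fun x => (w (φ x) : ℝ≥0∞)) (volume.restrict Ω) :=
    (hw.comp_aemeasurable (h.contDiffOn.continuousOn.aemeasurable hΩ)).coe_nnreal_ennreal
  have mD : AEMeasurable (fun x => ‖D (φ x)‖ₑ) (volume.restrict Ω) :=
    (h.locallyIntegrableOn_comp hfD.locallyIntegrableOn_deriv).aestronglyMeasurable.enorm
  have mφ : AEMeasurable (fun x => ‖fderiv ℝ φ x‖ₑ) (volume.restrict Ω) :=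
    (h.continuousOn_fderiv.aestronglyMeasurable hΩ).enorm
  have mA : AEMeasurable A (volume.restrict Ω) := mdet.mul ((mD.pow_const p).mul mw)
  have mG : AEMeasurable G (volume.restrict Ω) := (mφ.pow_const p).div (mdet.mul mw)
  have hpq : (p / s).HolderConjugate (p / (p - s)) := by
    rw [Real.holderConjugate_iff]
    refine ⟨(one_lt_div hs).2 hsp, ?_⟩
    field_simp
    ring
  have hle : ∫⁻ x in Ω, ‖weakFDeriv Ω (f ∘ φ) x‖ₑ ^ s * ((1 : ℝ≥0) : ℝ≥0∞) ≤
      ∫⁻ x in Ω, ((fun x => A x ^ (s / p)) * (fun x => G x ^ (s / p))) x := by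
    refine lintegral_mono_ae ?_
    filter_upwards [(h.hasWeakFDerivOn_comp hfD).weakFDeriv_ae_eq h.isOpen_source,
      ae_restrict_mem hΩ] with x hx hxΩ
    have d0 : ‖(fderiv ℝ φ x).det‖ₑ ≠ 0 := by simpa using h.det_ne_zero hxΩ
    have w0 : (w (φ x) : ℝ≥0∞) ≠ 0 := by simpa using hw0 _ (h.mapsTo hxΩ)
    -- The factor `|J| w ∘ φ` cancels in `[0, ∞]` because it is neither zero nor infinite.
    have e1 : A x * G x = (‖D (φ x)‖ₑ * ‖fderiv ℝ φ x‖ₑ) ^ p := by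
      have hW0 := mul_ne_zero d0 w0
      have hWt : ‖(fderiv ℝ φ x).det‖ₑ * (w (φ x) : ℝ≥0∞) ≠ ⊤ :=
        ENNReal.mul_ne_top enorm_ne_top ENNReal.coe_ne_top
      calc A x * G x = ‖D (φ x)‖ₑ ^ p * ((‖(fderiv ℝ φ x).det‖ₑ * (w (φ x) : ℝ≥0∞)) *
            (‖fderiv ℝ φ x‖ₑ ^ p / (‖(fderiv ℝ φ x).det‖ₑ * (w (φ x) : ℝ≥0∞)))) := by
            simp only [A, G]; ring
        _ = _ := by rw [ENNReal.mul_div_cancel hW0 hWt, ENNReal.mul_rpow_of_nonneg _ _ hp.le]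
    have e2 : A x ^ (s / p) * G x ^ (s / p) = (‖D (φ x)‖ₑ * ‖fderiv ℝ φ x‖ₑ) ^ s := by
      rw [← ENNReal.mul_rpow_of_nonneg _ _ (by positivity), e1, ← ENNReal.rpow_mul,
        mul_div_cancel₀ _ hp.ne']
    rw [hx, Pi.mul_apply, e2, ENNReal.coe_one, mul_one]
    refine ENNReal.rpow_le_rpow ?_ hs.le
    exact ContinuousLinearMap.opENorm_comp_le _ _
  have hH := hle.trans (ENNReal.lintegral_mul_le_Lp_mul_Lq (volume.restrict Ω) hpq
    (mA.pow_const (s / p)) (mG.pow_const (s / p)))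
  have hA : ∀ x, (A x ^ (s / p)) ^ (p / s) = A x := fun x => by
    rw [← ENNReal.rpow_mul, div_mul_div_cancel₀ hp.ne', div_self hs.ne', ENNReal.rpow_one]
  have hG : ∀ x, (G x ^ (s / p)) ^ (p / (p - s)) = G x ^ (s / (p - s)) := fun x => by
    rw [← ENNReal.rpow_mul, div_mul_div_cancel₀ hp.ne']
  simp only [hA, hG] at hH
  refine (ENNReal.rpow_le_rpow hH (by positivity : 0 ≤ 1 / s)).trans_eq ?_
  rw [ENNReal.mul_rpow_of_nonneg _ _ (by positivity : 0 ≤ 1 / s), ← ENNReal.rpow_mul,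
    ← ENNReal.rpow_mul, mul_comm]
  congr 2 <;> field_simp

theorem compositionNorm_le_distortionNorm (h : SmoothDiffeoOn φ η Ω Ω') {p s : ℝ} (hs : 0 < s)
    (hsp : s < p) {w : E → ℝ≥0} (hw : Measurable w) (hw0 : ∀ y ∈ Ω', w y ≠ 0)
    (hfin : distortionNorm p s Ω w φ < ⊤) :
    compositionNorm p s Ω Ω' w φ ≤ distortionNorm p s Ω w φ := by
  -- The distortion norm is itself an admissible constant; its finiteness is what puts `f ∘ φ` in
  -- the target space.
  refine sInf_le fun f hf => ?_
  have hle := h.sobolevSeminorm_comp_le hs hsp hw hw0 hf.1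
  exact ⟨⟨⟨_, h.hasWeakFDerivOn_comp hf.1.hasWeakFDerivOn⟩,
    hle.trans_lt (ENNReal.mul_lt_top hfin hf.2)⟩, hle⟩

end SmoothDiffeoOn

end CompositionOperator

/-! ### Bounded open polyhedra are Lipschitz domains -/

section Polyhedra

variable {E : Type*} [NormedAddCommGroup E] [InnerProductSpace ℝ E]

theorem LipschitzWith.finset_sup' {ι X : Type*} [PseudoMetricSpace X] {t : Finset ι}
    (ht : t.Nonempty) {g : ι → X → ℝ} {L : ℝ≥0} (hg : ∀ i ∈ t, LipschitzWith L (g i)) :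
    LipschitzWith L fun x => t.sup' ht fun i => g i x := by
  refine LipschitzWith.of_le_add_mul L fun x y => Finset.sup'_le _ _ fun i hi => ?_
  exact ((hg i hi).le_add_mul x y).trans
    (add_le_add_left (Finset.le_sup' (fun i => g i y) hi) _)

theorem convex_polyhedron {ι : Type*} (l : ι → E →L[ℝ] ℝ) (b : ι → ℝ) :
    Convex ℝ {x | ∀ i, l i x < b i} := by
  simp only [ofPred_forall]
  exact convex_iInter fun i => convex_halfSpace_lt (l i).isLinear (b i)

/-- A nonempty bounded open polyhedron is a Lipschitz domain. -/
theorem isLipschitzDomain_polyhedron {ι : Type*} [Fintype ι] (l : ι → E →L[ℝ] ℝ) (b : ι → ℝ)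
    (hb : Bornology.IsBounded {x | ∀ i, l i x < b i}) (hne : {x | ∀ i, l i x < b i}.Nonempty) :
    IsLipschitzDomain {x | ∀ i, l i x < b i} := by
  have hopen : IsOpen {x | ∀ i, l i x < b i} := by
    simp only [ofPred_forall]
    exact isOpen_iInter_of_finite fun i => isOpen_lt (l i).continuous continuous_const
  refine ⟨⟨hopen, hne, (convex_polyhedron l b).isPreconnected⟩, hb, fun x hx => ?_⟩
  have hxle : ∀ i, l i x ≤ b i := fun i =>
    closure_minimal (fun y (hy : ∀ i, l i y < b i) => (hy i).le)
      (isClosed_le (l i).continuous continuous_const) (frontier_subset_closure hx)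
  have hxn : x ∉ {x | ∀ i, l i x < b i} := fun h => by
    rw [hopen.frontier_eq] at hx
    exact hx.2 h
  obtain ⟨z, hz⟩ := hne
  classical
  -- The constraints active at `x`; the others remain strict in a small ball around `x`.
  let t : Finset ι := Finset.univ.filter fun i => l i x = b i
  have ht : t.Nonempty := by
    by_contra hn
    refine hxn fun i => lt_of_le_of_ne (hxle i) fun he => hn ⟨i, by simp [t, he]⟩
  have hzx : 0 < ‖z - x‖ := norm_pos_iff.2 (sub_ne_zero.2 fun h => hxn (h ▸ hz))
  -- Pointing from `x` to an interior point, `ν` strictly decreases every active form. Each active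
  -- inequality can then be solved for the height `⟪ν, y⟫`, and the graph function is the maximum of
  -- the resulting affine functions `g i`.
  let ν : E := ‖z - x‖⁻¹ • (z - x)
  have hν : ∀ i ∈ t, l i ν < 0 := by
    intro i hi
    have hi' : l i x = b i := by simpa [t] using hi
    have : l i (z - x) < 0 := by
      rw [map_sub, hi']
      exact sub_neg.2 (hz i)
    simp only [ν, map_smul, smul_eq_mul]
    exact mul_neg_of_pos_of_neg (inv_pos.2 hzx) this
  let g : ι → E → ℝ := fun i y => (-l i ν)⁻¹ * (l i y - b i)
  let L : ℝ≥0 := Finset.univ.sup fun i => ‖(-l i ν)⁻¹‖₊ * ‖l i‖₊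
  have hg : ∀ i ∈ t, LipschitzWith L (g i) := by
    intro i _
    have h1 : LipschitzWith (‖(-l i ν)⁻¹‖₊ * ‖l i‖₊) (g i) := by
      refine LipschitzWith.of_dist_le_mul fun y y' => ?_
      have : g i y - g i y' = (-l i ν)⁻¹ * l i (y - y') := by
        simp only [g, map_sub]; ring
      rw [Real.dist_eq, this, abs_mul, dist_eq_norm, NNReal.coe_mul, mul_assoc]
      exact mul_le_mul_of_nonneg_left ((l i).le_opNorm _) (abs_nonneg _)
    exact h1.weaken (Finset.le_sup (f := fun i => ‖(-l i ν)⁻¹‖₊ * ‖l i‖₊) (Finset.mem_univ i))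
  have hU : IsOpen {y | ∀ i, i ∉ t → l i y < b i} := by
    simp only [ofPred_forall]
    exact isOpen_iInter_of_finite fun i => isOpen_iInter_of_finite fun _ =>
      isOpen_lt (l i).continuous continuous_const
  obtain ⟨r, hr, hball⟩ := Metric.isOpen_iff.1 hU x fun i hi =>
    lt_of_le_of_ne (hxle i) fun he => hi (by simp [t, he])
  refine ⟨ν, ?_, L, _, LipschitzWith.finset_sup' ht hg, r, hr, fun y hy => ?_⟩
  · simp [ν, norm_smul, hzx.ne']
  have hkey : ∀ i ∈ t, (g i (y - ⟪ν, y⟫ • ν) < ⟪ν, y⟫ ↔ l i y < b i) := by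
    intro i hi
    have h0 : 0 < -l i ν := neg_pos.2 (hν i hi)
    simp only [g, map_sub, map_smul, smul_eq_mul]
    rw [inv_mul_lt_iff₀ h0]
    constructor <;> intro h <;> linarith
  rw [Finset.sup'_lt_iff]
  constructor
  · exact fun h i hi => (hkey i hi).2 (h i)
  · intro h i
    by_cases hi : i ∈ t
    · exact (hkey i hi).1 (h i hi)
    · exact hball hy i hi

end Polyhedra

/-! ### Geometry of the cuspidal and base domains -/

section CuspGeometry

variable {m : ℕ}

theorem mem_baseDomain {x : EuclideanSpace ℝ (Fin (m + 1))} :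
    x ∈ baseDomain m ↔ (0 < x (Fin.last m) ∧ x (Fin.last m) < 1) ∧
      ∀ i : Fin m, 0 < x i.castSucc ∧ x i.castSucc < x (Fin.last m) := by
  simp [baseDomain, cuspDomain]

theorem EuclideanSpace.norm_le_sqrt_mul {n : ℕ} {x : EuclideanSpace ℝ (Fin n)} {c : ℝ}
    (hc : 0 ≤ c) (h : ∀ i, |x i| ≤ c) : ‖x‖ ≤ √n * c := by
  rw [EuclideanSpace.norm_eq]
  refine Real.sqrt_le_iff.2 ⟨by positivity, ?_⟩
  rw [mul_pow, Real.sq_sqrt (by positivity)]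
  calc ∑ i, ‖x i‖ ^ 2 ≤ ∑ _i : Fin n, c ^ 2 :=
        Finset.sum_le_sum fun i _ => pow_le_pow_left₀ (norm_nonneg _) (h i) 2
    _ = n * c ^ 2 := by simp

theorem isBounded_cuspDomain {γ : Fin m → ℝ} (hγ : ∀ i, 1 ≤ γ i) :
    Bornology.IsBounded (cuspDomain γ) := by
  refine isBounded_closedBall.subset (s := cuspDomain γ) (t := closedBall 0 (√(m + 1 : ℕ) * 1)) ?_
  intro x hx
  rw [mem_closedBall_zero_iff]
  refine EuclideanSpace.norm_le_sqrt_mul zero_le_one fun i => ?_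
  induction i using Fin.lastCases with
  | last => rw [abs_of_pos hx.1.1]; exact hx.1.2.le
  | cast i =>
    rw [abs_of_pos (hx.2 i).1]
    exact (hx.2 i).2.le.trans
      (Real.rpow_le_one hx.1.1.le hx.1.2.le (zero_le_one.trans (hγ i)))

theorem isOpen_cuspDomain {γ : Fin m → ℝ} (hγ : ∀ i, 1 ≤ γ i) : IsOpen (cuspDomain γ) := by
  have hc : ∀ j : Fin (m + 1), Continuous fun x : EuclideanSpace ℝ (Fin (m + 1)) => x j :=
    fun j => (EuclideanSpace.proj j).continuous
  simp only [cuspDomain, ofPred_and, ofPred_forall]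
  refine ((isOpen_lt continuous_const (hc _)).inter (isOpen_lt (hc _) continuous_const)).inter
    (isOpen_iInter_of_finite fun i => (isOpen_lt continuous_const (hc _)).inter
      (isOpen_lt (hc _) ((hc _).rpow_const fun _ => Or.inr (zero_le_one.trans (hγ i)))))

/-- The linear forms that define the polyhedron `Ω_n`. -/
noncomputable def baseForm (m : ℕ) :
    (Fin m ⊕ Fin m) ⊕ Bool → EuclideanSpace ℝ (Fin (m + 1)) →L[ℝ] ℝ :=
  Sum.elim
    (Sum.elim (fun i => -EuclideanSpace.proj i.castSucc)
      fun i => EuclideanSpace.proj i.castSucc - EuclideanSpace.proj (Fin.last m))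
    fun c => cond c (EuclideanSpace.proj (Fin.last m)) (-EuclideanSpace.proj (Fin.last m))

/-- The right hand sides of the inequalities that define the polyhedron `Ω_n`. -/
noncomputable def baseBound (m : ℕ) : (Fin m ⊕ Fin m) ⊕ Bool → ℝ :=
  Sum.elim (fun _ => 0) fun c => cond c 1 0

theorem baseDomain_eq_polyhedron :
    baseDomain m = {x | ∀ i, baseForm m i x < baseBound m i} := by
  ext x
  simp only [mem_baseDomain, mem_ofPred_eq, Sum.forall, Bool.forall_bool, baseForm, baseBound,
    Sum.elim_inl, Sum.elim_inr, cond_true, cond_false, neg_apply,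
    sub_apply, PiLp.proj_apply, neg_lt_zero, sub_neg, forall_and]
  tauto

theorem nonempty_baseDomain : (baseDomain m).Nonempty := by
  refine ⟨WithLp.toLp 2 (Fin.snoc (α := fun _ => ℝ) (fun _ => 1 / 4) (1 / 2)), ?_⟩
  simp only [mem_baseDomain, Fin.snoc_last, Fin.snoc_castSucc]
  norm_num

theorem isLipschitzDomain_baseDomain : IsLipschitzDomain (baseDomain m) := by
  have hb : Bornology.IsBounded (baseDomain m) := isBounded_cuspDomain fun _ => le_rfl
  have hne := nonempty_baseDomain (m := m)
  rw [baseDomain_eq_polyhedron] at hb hne ⊢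
  exact isLipschitzDomain_polyhedron _ _ hb hne

theorem convex_baseDomain : Convex ℝ (baseDomain m) := by
  rw [baseDomain_eq_polyhedron]
  exact convex_polyhedron _ _

end CuspGeometry

/-! ### The map `φ_a`: inverse, derivative, Jacobian and weight -/

section CuspMap

/-- The coordinate functional `x ↦ x j`. -/
noncomputable abbrev coordCLM {n : ℕ} (j : Fin n) : EuclideanSpace ℝ (Fin n) →L[ℝ] ℝ :=
  EuclideanSpace.proj j

variable {m : ℕ} (γ : Fin m → ℝ) (a : ℝ)

@[simp]
theorem cuspMap_castSucc (x : EuclideanSpace ℝ (Fin (m + 1))) (i : Fin m) :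
    cuspMap γ a x i.castSucc =
      x i.castSucc / x (Fin.last m) * (x (Fin.last m) ^ γ i) ^ a := by
  simp [cuspMap]

@[simp]
theorem cuspMap_last (x : EuclideanSpace ℝ (Fin (m + 1))) :
    cuspMap γ a x (Fin.last m) = x (Fin.last m) ^ a := by
  simp [cuspMap]

/-- The inverse of `cuspMap`. -/
noncomputable def cuspInv (y : EuclideanSpace ℝ (Fin (m + 1))) : EuclideanSpace ℝ (Fin (m + 1)) :=
  WithLp.toLp 2 (Fin.snoc (α := fun _ => ℝ)
    (fun i : Fin m => y i.castSucc * y (Fin.last m) ^ (a⁻¹ - γ i)) (y (Fin.last m) ^ a⁻¹))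

@[simp]
theorem cuspInv_castSucc (y : EuclideanSpace ℝ (Fin (m + 1))) (i : Fin m) :
    cuspInv γ a y i.castSucc = y i.castSucc * y (Fin.last m) ^ (a⁻¹ - γ i) := by
  simp [cuspInv]

@[simp]
theorem cuspInv_last (y : EuclideanSpace ℝ (Fin (m + 1))) :
    cuspInv γ a y (Fin.last m) = y (Fin.last m) ^ a⁻¹ := by
  simp [cuspInv]

variable {γ a}

/-- Merging the powers of `x_n` gives the form that is differentiated and inverted below. -/
theorem cuspMap_castSucc_of_pos {x : EuclideanSpace ℝ (Fin (m + 1))} (hx : 0 < x (Fin.last m))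
    (i : Fin m) : cuspMap γ a x i.castSucc = x i.castSucc * x (Fin.last m) ^ (a * γ i - 1) := by
  rw [cuspMap_castSucc, ← Real.rpow_mul hx.le, Real.rpow_sub_one hx.ne', mul_comm a]
  ring

theorem smoothDiffeoOn_cuspMap (hγ : ∀ i, 1 ≤ γ i) (ha : 0 < a) :
    SmoothDiffeoOn (cuspMap γ a) (cuspInv γ a) (baseDomain m) (cuspDomain γ) where
  isOpen_source := isOpen_cuspDomain fun _ => le_rfl
  isOpen_target := isOpen_cuspDomain hγ
  contDiffOn := by
    have hc : ∀ j : Fin (m + 1), ContDiff ℝ ∞ fun x : EuclideanSpace ℝ (Fin (m + 1)) => x j :=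
      fun j => contDiff_euclidean.1 contDiff_id j
    refine contDiffOn_euclidean.2 fun j => ?_
    induction j using Fin.lastCases with
    | last =>
      simp only [cuspMap_last]
      exact fun x hx => ((hc _).contDiffAt.rpow_const_of_ne hx.1.1.ne').contDiffWithinAt
    | cast i =>
      refine ContDiffOn.congr (fun x hx => ?_) fun x hx => cuspMap_castSucc_of_pos hx.1.1 i
      exact ((hc _).contDiffAt.mul
        ((hc _).contDiffAt.rpow_const_of_ne hx.1.1.ne')).contDiffWithinAt
  contDiffOn_inv := by
    have hc : ∀ j : Fin (m + 1), ContDiff ℝ ∞ fun x : EuclideanSpace ℝ (Fin (m + 1)) => x j :=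
      fun j => contDiff_euclidean.1 contDiff_id j
    refine contDiffOn_euclidean.2 fun j => ?_
    induction j using Fin.lastCases with
    | last =>
      simp only [cuspInv_last]
      exact fun x hx => ((hc _).contDiffAt.rpow_const_of_ne hx.1.1.ne').contDiffWithinAt
    | cast i =>
      simp only [cuspInv_castSucc]
      exact fun x hx => ((hc _).contDiffAt.mul
        ((hc _).contDiffAt.rpow_const_of_ne hx.1.1.ne')).contDiffWithinAt
  mapsTo := by
    intro x hx
    rw [mem_baseDomain] at hx
    obtain ⟨⟨h0, h1⟩, h⟩ := hx
    refine ⟨?_, fun i => ?_⟩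
    · rw [cuspMap_last]
      exact ⟨Real.rpow_pos_of_pos h0 a, Real.rpow_lt_one h0.le h1 ha⟩
    · rw [cuspMap_last, cuspMap_castSucc, ← Real.rpow_mul h0.le, ← Real.rpow_mul h0.le,
        mul_comm (γ i) a]
      have hp : 0 < x (Fin.last m) ^ (a * γ i) := Real.rpow_pos_of_pos h0 _
      have hi := (h i).1
      exact ⟨by positivity, mul_lt_of_lt_one_left hp ((div_lt_one h0).2 (h i).2)⟩
  mapsTo_inv := by
    intro y hy
    obtain ⟨⟨h0, h1⟩, h⟩ := hy
    rw [mem_baseDomain]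
    refine ⟨?_, fun i => ?_⟩
    · rw [cuspInv_last]
      exact ⟨Real.rpow_pos_of_pos h0 _, Real.rpow_lt_one h0.le h1 (inv_pos.2 ha)⟩
    · rw [cuspInv_last, cuspInv_castSucc]
      have hp : 0 < y (Fin.last m) ^ (a⁻¹ - γ i) := Real.rpow_pos_of_pos h0 _
      refine ⟨mul_pos (h i).1 hp, (mul_lt_mul_of_pos_right (h i).2 hp).trans_eq ?_⟩
      rw [← Real.rpow_add h0]
      congr 1
      ring
  leftInvOn := by
    intro x hx
    have h0 := hx.1.1
    ext j
    induction j using Fin.lastCases with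
    | last => rw [cuspInv_last, cuspMap_last, Real.rpow_rpow_inv h0.le ha.ne']
    | cast i =>
      rw [cuspInv_castSucc, cuspMap_last, cuspMap_castSucc_of_pos h0, ← Real.rpow_mul h0.le,
        mul_assoc, ← Real.rpow_add h0]
      convert! mul_one _
      convert! Real.rpow_zero _ using 2
      field_simp
      ring
  rightInvOn := by
    intro y hy
    have h0 := hy.1.1
    ext j
    induction j using Fin.lastCases with
    | last => rw [cuspMap_last, cuspInv_last, Real.rpow_inv_rpow h0.le ha.ne']
    | cast i =>
      have h0' : 0 < cuspInv γ a y (Fin.last m) := by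
        rw [cuspInv_last]
        exact Real.rpow_pos_of_pos h0 _
      rw [cuspMap_castSucc_of_pos h0', cuspInv_last, cuspInv_castSucc, ← Real.rpow_mul h0.le,
        mul_assoc, ← Real.rpow_add h0]
      convert! mul_one _
      convert! Real.rpow_zero _ using 2
      field_simp
      ring

theorem fderiv_cuspMap_last (hγ : ∀ i, 1 ≤ γ i) (ha : 0 < a)
    {x : EuclideanSpace ℝ (Fin (m + 1))} (hx : x ∈ baseDomain m)
    (v : EuclideanSpace ℝ (Fin (m + 1))) :
    fderiv ℝ (cuspMap γ a) x v (Fin.last m) =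
      a * x (Fin.last m) ^ (a - 1) * v (Fin.last m) := by
  have h1 : HasFDerivAt (fun x => cuspMap γ a x (Fin.last m)) _ x :=
    (coordCLM (Fin.last m)).hasFDerivAt.comp x
      ((smoothDiffeoOn_cuspMap hγ ha).hasFDerivAt hx)
  have h2 := (coordCLM (Fin.last m)).hasFDerivAt (x := x)
    |>.rpow_const (p := a) (Or.inl hx.1.1.ne')
  simp only [cuspMap_last] at h1
  have := congrArg (fun A => A v) (h1.unique h2)
  simpa using this

theorem fderiv_cuspMap_castSucc (hγ : ∀ i, 1 ≤ γ i) (ha : 0 < a)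
    {x : EuclideanSpace ℝ (Fin (m + 1))} (hx : x ∈ baseDomain m)
    (v : EuclideanSpace ℝ (Fin (m + 1))) (i : Fin m) :
    fderiv ℝ (cuspMap γ a) x v i.castSucc =
      x (Fin.last m) ^ (a * γ i - 1) * (v i.castSucc +
        (a * γ i - 1) * (x i.castSucc / x (Fin.last m)) * v (Fin.last m)) := by
  have h0 := hx.1.1
  have h1 : HasFDerivAt (fun x => cuspMap γ a x i.castSucc) _ x :=
    (coordCLM i.castSucc).hasFDerivAt.comp x
      ((smoothDiffeoOn_cuspMap hγ ha).hasFDerivAt hx)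
  have h2 := (coordCLM i.castSucc).hasFDerivAt (x := x) |>.mul
    ((coordCLM (Fin.last m)).hasFDerivAt (x := x)
    |>.rpow_const (p := a * γ i - 1) (Or.inl h0.ne'))
  have h3 : HasFDerivAt (fun x => cuspMap γ a x i.castSucc) _ x :=
    h2.congr_of_eventuallyEq <| Filter.eventually_of_mem
      ((isOpen_cuspDomain fun _ => le_rfl).mem_nhds hx) fun y hy => cuspMap_castSucc_of_pos hy.1.1 i
  have := congrArg (fun A => A v) (h1.unique h3)
  simp [Real.rpow_sub_one h0.ne' (a * γ i - 1)] at this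
  rw [this]
  ring

theorem det_fderiv_cuspMap (hγ : ∀ i, 1 ≤ γ i) (ha : 0 < a)
    {x : EuclideanSpace ℝ (Fin (m + 1))} (hx : x ∈ baseDomain m) :
    (fderiv ℝ (cuspMap γ a) x).det =
      a * x (Fin.last m) ^ (a * cuspExponent γ - (m + 1)) := by
  have h0 := hx.1.1
  let b := (EuclideanSpace.basisFun (Fin (m + 1)) ℝ).toBasis
  have hM : ∀ i j, LinearMap.toMatrix b b (fderiv ℝ (cuspMap γ a) x) i j =
      fderiv ℝ (cuspMap γ a) x (EuclideanSpace.single j 1) i := by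
    intro i j
    simp [b, LinearMap.toMatrix_apply]
  -- Component `i < n` depends only on `x_i` and `x_n`, and the last one only on `x_n`: the only
  -- off-diagonal entries lie in the last column.
  have ht : (LinearMap.toMatrix b b (fderiv ℝ (cuspMap γ a) x)).BlockTriangular id := by
    intro i j hij
    rw [hM]
    induction i using Fin.lastCases with
    | last =>
      rw [fderiv_cuspMap_last hγ ha hx]
      simp [(show j < Fin.last m from hij).ne']
    | cast i =>
      rw [fderiv_cuspMap_castSucc hγ ha hx]
      have h1 : j < i.castSucc := hij
      have h2 : j < Fin.last m := h1.trans i.castSucc_lt_last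
      simp [h1.ne', h2.ne']
  rw [ContinuousLinearMap.det, ← LinearMap.det_toMatrix b, Matrix.det_of_isUpperTriangular ht,
    Fin.prod_univ_castSucc]
  simp only [hM, fderiv_cuspMap_last hγ ha hx, fderiv_cuspMap_castSucc hγ ha hx]
  have hne : ∀ i : Fin m, Fin.last m ≠ i.castSucc := fun i => i.castSucc_lt_last.ne'
  simp only [PiLp.single_apply, hne, if_true, if_false, mul_zero, add_zero, mul_one]
  rw [← Real.rpow_sum_of_pos h0, mul_left_comm, ← Real.rpow_add h0]
  congr 2
  simp [cuspExponent, Finset.sum_sub_distrib, Finset.mul_sum, mul_add]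
  ring

/-- Each row is estimated by Cauchy–Schwarz and the squares are added. Row `i` contributes `1 + (a
γ_i - 1)²`, the last row `a²`, which is the sum under the root. -/
theorem norm_fderiv_cuspMap_le (hγ : ∀ i, 1 ≤ γ i) (ha : 0 < a)
    {x : EuclideanSpace ℝ (Fin (m + 1))} (hx : x ∈ baseDomain m) :
    ‖fderiv ℝ (cuspMap γ a) x‖ ≤
      √((∑ i, (a * γ i - 1) ^ 2) + m + a ^ 2) * x (Fin.last m) ^ (a - 1) := by
  obtain ⟨⟨h0, h1⟩, hxi⟩ := mem_baseDomain.1 hx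
  set t := x (Fin.last m)
  set X := t ^ (a - 1) with hX
  have hX0 : 0 < X := Real.rpow_pos_of_pos h0 _
  refine ContinuousLinearMap.opNorm_le_bound _ (by positivity) fun v => ?_
  refine le_of_sq_le_sq ?_ (by positivity)
  rw [mul_pow, mul_pow, Real.sq_sqrt (by positivity), EuclideanSpace.norm_sq_eq,
    Fin.sum_univ_castSucc]
  have hvn : ‖v‖ ^ 2 = ∑ i : Fin m, v i.castSucc ^ 2 + v (Fin.last m) ^ 2 := by
    rw [EuclideanSpace.norm_sq_eq, Fin.sum_univ_castSucc]
    simp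
  have hlast : ‖fderiv ℝ (cuspMap γ a) x v (Fin.last m)‖ ^ 2 ≤ a ^ 2 * X ^ 2 * ‖v‖ ^ 2 := by
    rw [fderiv_cuspMap_last hγ ha hx, Real.norm_eq_abs, sq_abs, mul_pow, mul_pow]
    refine mul_le_mul_of_nonneg_left ?_ (by positivity)
    rw [hvn]
    have : 0 ≤ ∑ i : Fin m, v i.castSucc ^ 2 := Finset.sum_nonneg fun i _ => sq_nonneg _
    linarith
  have hcast : ∀ i : Fin m, ‖fderiv ℝ (cuspMap γ a) x v i.castSucc‖ ^ 2 ≤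
      (1 + (a * γ i - 1) ^ 2) * X ^ 2 * ‖v‖ ^ 2 := by
    intro i
    rw [fderiv_cuspMap_castSucc hγ ha hx, Real.norm_eq_abs, sq_abs, mul_pow]
    -- Here `t < 1` and `γ i ≥ 1` turn every power into the common one `t ^ (a - 1)`.
    have hle : t ^ (a * γ i - 1) ≤ X :=
      Real.rpow_le_rpow_of_exponent_ge h0 h1.le (by nlinarith [hγ i])
    have hle2 : (t ^ (a * γ i - 1)) ^ 2 ≤ X ^ 2 :=
      pow_le_pow_left₀ (Real.rpow_nonneg h0.le _) hle 2
    set q := x i.castSucc / t with hq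
    have hq0 : 0 ≤ q := div_nonneg (hxi i).1.le h0.le
    have hq1 : q ≤ 1 := (div_le_one h0).2 (hxi i).2.le
    have hvi : v i.castSucc ^ 2 + v (Fin.last m) ^ 2 ≤ ‖v‖ ^ 2 := by
      rw [hvn]
      have := Finset.single_le_sum (f := fun i : Fin m => v i.castSucc ^ 2)
        (fun i _ => sq_nonneg _) (Finset.mem_univ i)
      simpa using this
    have hcs : (v i.castSucc + (a * γ i - 1) * q * v (Fin.last m)) ^ 2 ≤
        (1 + (a * γ i - 1) ^ 2) * ‖v‖ ^ 2 := by
      have hd : ((a * γ i - 1) * q) ^ 2 ≤ (a * γ i - 1) ^ 2 := by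
        rw [mul_pow]
        exact mul_le_of_le_one_right (sq_nonneg _) (pow_le_one₀ hq0 hq1)
      calc _ ≤ (1 + ((a * γ i - 1) * q) ^ 2) * (v i.castSucc ^ 2 + v (Fin.last m) ^ 2) := by
            -- Lagrange's identity: the difference of the two sides is exactly this square.
            nlinarith [sq_nonneg (v (Fin.last m) - (a * γ i - 1) * q * v i.castSucc)]
        _ ≤ _ := by gcongr
    calc _ ≤ X ^ 2 * ((1 + (a * γ i - 1) ^ 2) * ‖v‖ ^ 2) := by gcongr
      _ = _ := by ring
  calc _ ≤ ∑ i : Fin m, (1 + (a * γ i - 1) ^ 2) * X ^ 2 * ‖v‖ ^ 2 + a ^ 2 * X ^ 2 * ‖v‖ ^ 2 :=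
        add_le_add (Finset.sum_le_sum fun i _ => hcast i) hlast
    _ = _ := by
        rw [← Finset.sum_mul, ← Finset.sum_mul, Finset.sum_add_distrib]
        simp
        ring

/-- The constant in the lower bound of the weight `|x|^α` on the cuspidal domain. -/
noncomputable def weightConst (m : ℕ) (α : ℝ) : ℝ := min 1 (√(m + 1 : ℕ) ^ α)

theorem weightConst_pos (m : ℕ) (α : ℝ) : 0 < weightConst m α :=
  lt_min one_pos (Real.rpow_pos_of_pos (Real.sqrt_pos.2 (by positivity)) _)

theorem norm_pos_of_mem_cuspDomain {y : EuclideanSpace ℝ (Fin (m + 1))} (hy : y ∈ cuspDomain γ) :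
    0 < ‖y‖ :=
  (abs_pos.2 hy.1.1.ne').trans_le (PiLp.norm_apply_le y (Fin.last m))

/-- On the cusp `y_n ≤ ‖y‖ ≤ √n y_n`, the second since `y_i < y_n ^ γ_i ≤ y_n`. The first inequality
serves `α ≥ 0`, the second `α ≤ 0`; the minimum in `weightConst` covers both. -/
theorem weightConst_mul_le (hγ : ∀ i, 1 ≤ γ i) (α : ℝ)
    {y : EuclideanSpace ℝ (Fin (m + 1))} (hy : y ∈ cuspDomain γ) :
    weightConst m α * y (Fin.last m) ^ α ≤ ‖y‖ ^ α := by
  obtain ⟨⟨h0, h1⟩, hyi⟩ := hy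
  have hp : 0 < y (Fin.last m) ^ α := Real.rpow_pos_of_pos h0 α
  rcases le_total 0 α with hα | hα
  · refine (mul_le_of_le_one_left hp.le (min_le_left _ _)).trans
      (Real.rpow_le_rpow h0.le ?_ hα)
    exact (le_abs_self _).trans (PiLp.norm_apply_le y (Fin.last m))
  · refine (mul_le_mul_of_nonneg_right (min_le_right _ _) hp.le).trans ?_
    rw [← Real.mul_rpow (by positivity) h0.le]
    refine Real.rpow_le_rpow_of_nonpos (norm_pos_of_mem_cuspDomain ⟨⟨h0, h1⟩, hyi⟩) ?_ hα
    refine EuclideanSpace.norm_le_sqrt_mul h0.le fun i => ?_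
    induction i using Fin.lastCases with
    | last => rw [abs_of_pos h0]
    | cast i =>
      rw [abs_of_pos (hyi i).1]
      refine (hyi i).2.le.trans ?_
      simpa using Real.rpow_le_rpow_of_exponent_ge h0 h1.le (hγ i)

end CuspMap

/-! ### Integrals of powers of `x_n` over the base domain -/

section SliceIntegral

theorem lintegral_rpow_Ioo {r : ℝ} (hr : -1 < r) :
    ∫⁻ t in Ioo (0 : ℝ) 1, ENNReal.ofReal (t ^ r) = ENNReal.ofReal (1 / (r + 1)) := by
  have hi : IntegrableOn (fun t : ℝ => t ^ r) (Ioc 0 1) :=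
    (intervalIntegrable_iff_integrableOn_Ioc_of_le zero_le_one).1
      (intervalIntegral.intervalIntegrable_rpow' hr)
  rw [restrict_Ioo_eq_restrict_Ioc, ← ofReal_integral_eq_lintegral_ofReal hi,
    ← intervalIntegral.integral_of_le zero_le_one, integral_rpow (Or.inl hr)]
  · rw [Real.one_rpow, Real.zero_rpow (by linarith), sub_zero]
  · exact (ae_restrict_iff' measurableSet_Ioc).2
      (Filter.Eventually.of_forall fun t ht => Real.rpow_nonneg ht.1.le r)

/-- By Tonelli: the slice at height `t` is a cube of volume `t ^ m`, which leaves the integral of `t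
^ (q + m)` over `(0, 1)`. -/
theorem lintegral_baseDomain_rpow (m : ℕ) {q : ℝ} (hq : 0 < q + (m + 1)) :
    ∫⁻ x in baseDomain m, ENNReal.ofReal (x (Fin.last m) ^ q) =
      ENNReal.ofReal (1 / (q + (m + 1))) := by
  let e := (MeasurableEquiv.piFinSuccAbove (fun _ : Fin (m + 1) => ℝ) (Fin.last m))
  have he : MeasurePreserving (fun x : EuclideanSpace ℝ (Fin (m + 1)) => e (WithLp.ofLp x)) :=
    (volume_preserving_piFinSuccAbove (fun _ : Fin (m + 1) => ℝ) (Fin.last m)).comp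
      (PiLp.volume_preserving_ofLp _)
  let S : Set (ℝ × (Fin m → ℝ)) := {z | z.1 ∈ Ioo 0 1 ∧ z.2 ∈ univ.pi fun _ => Ioo 0 z.1}
  have hS : MeasurableSet S := by
    refine IsOpen.measurableSet ?_
    simp only [S, mem_Ioo, mem_univ_pi, ofPred_and, ofPred_forall]
    refine ((isOpen_lt continuous_const continuous_fst).inter
      (isOpen_lt continuous_fst continuous_const)).inter (isOpen_iInter_of_finite fun i => ?_)
    exact (isOpen_lt continuous_const ((continuous_apply i).comp continuous_snd)).inter
      (isOpen_lt ((continuous_apply i).comp continuous_snd) continuous_fst)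
  have hpre : baseDomain m = (fun x => e (WithLp.ofLp x)) ⁻¹' S := by
    ext x
    rw [mem_baseDomain]
    simp [S, e, MeasurableEquiv.piFinSuccAbove]
    exact fun _ _ => Iff.rfl
  have hf : Measurable fun z : ℝ × (Fin m → ℝ) => ENNReal.ofReal (z.1 ^ q) :=
    (measurable_fst.pow_const q).ennreal_ofReal
  have h1 := he.setLIntegral_comp_preimage hS hf
  rw [← hpre] at h1
  refine Eq.trans h1 ?_
  rw [← lintegral_indicator hS, Measure.volume_eq_prod,
    lintegral_prod _ (hf.indicator hS).aemeasurable,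
    show q + (m + 1) = (q + m) + 1 by ring, ← lintegral_rpow_Ioo (by linarith),
    ← lintegral_indicator measurableSet_Ioo]
  refine lintegral_congr fun t => ?_
  by_cases ht : t ∈ Ioo (0 : ℝ) 1
  · have : ∀ y : Fin m → ℝ, S.indicator (fun z => ENNReal.ofReal (z.1 ^ q)) (t, y) =
        (univ.pi fun _ => Ioo 0 t).indicator (fun _ => ENNReal.ofReal (t ^ q)) y := by
      intro y
      by_cases hy : y ∈ univ.pi fun _ : Fin m => Ioo 0 t
      · rw [indicator_of_mem hy, indicator_of_mem (show (t, y) ∈ S from ⟨ht, hy⟩)]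
      · rw [indicator_of_notMem hy, indicator_of_notMem fun h : (t, y) ∈ S => hy h.2]
    simp_rw [this]
    rw [lintegral_indicator_const (MeasurableSet.univ_pi fun _ => measurableSet_Ioo),
      Real.volume_pi_Ioo, indicator_of_mem ht]
    simp only [sub_zero, Finset.prod_const, Finset.card_univ, Fintype.card_fin]
    rw [← ENNReal.ofReal_pow ht.1.le, ← ENNReal.ofReal_mul (Real.rpow_nonneg ht.1.le _),
      Real.rpow_add_natCast ht.1.ne']
  · rw [indicator_of_notMem ht]
    have : ∀ y : Fin m → ℝ, S.indicator (fun z => ENNReal.ofReal (z.1 ^ q)) (t, y) = 0 :=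
      fun y => indicator_of_notMem (fun h : (t, y) ∈ S => ht h.1) _
    simp [this]

end SliceIntegral

/-! ### The distortion of `φ_a` and the final estimate -/

section CuspDistortion

variable {m : ℕ} {γ : Fin m → ℝ} {a : ℝ}

/-- Combines the upper bound on the derivative, the exact Jacobian and the lower bound on the
weight; the rest is collecting exponents of `x_n`. -/
theorem distortion_quotient_le (hγ : ∀ i, 1 ≤ γ i) (ha : 0 < a) (α : ℝ) {p : ℝ} (hp : 0 < p)
    {x : EuclideanSpace ℝ (Fin (m + 1))} (hx : x ∈ baseDomain m) :
    ‖fderiv ℝ (cuspMap γ a) x‖ ^ p /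
        (|(fderiv ℝ (cuspMap γ a) x).det| * ‖cuspMap γ a x‖ ^ α) ≤
      √((∑ i, (a * γ i - 1) ^ 2) + m + a ^ 2) ^ p / (a * weightConst m α) *
        x (Fin.last m) ^ ((m : ℝ) + 1 - p - a * (α + cuspExponent γ - p)) := by
  have h0 := hx.1.1
  have hc := weightConst_pos m α
  have hw := weightConst_mul_le hγ α ((smoothDiffeoOn_cuspMap hγ ha).mapsTo hx)
  have hn := norm_fderiv_cuspMap_le hγ ha hx
  rw [det_fderiv_cuspMap hγ ha hx]
  rw [cuspMap_last, ← Real.rpow_mul h0.le] at hw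
  set t := x (Fin.last m)
  set C := √((∑ i, (a * γ i - 1) ^ 2) + m + a ^ 2)
  have hC : 0 ≤ C := Real.sqrt_nonneg _
  have hj : 0 < a * t ^ (a * cuspExponent γ - (m + 1)) :=
    mul_pos ha (Real.rpow_pos_of_pos h0 _)
  rw [abs_of_pos hj]
  calc _ ≤ (C * t ^ (a - 1)) ^ p /
        (a * t ^ (a * cuspExponent γ - (m + 1)) * (weightConst m α * t ^ (a * α))) := by
        gcongr
    _ = C ^ p / (a * weightConst m α) *
        (t ^ ((a - 1) * p) / (t ^ (a * cuspExponent γ - (m + 1)) * t ^ (a * α))) := by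
        rw [Real.mul_rpow hC (Real.rpow_nonneg h0.le _), ← Real.rpow_mul h0.le,
          div_mul_div_comm]
        ring
    _ = _ := by
        rw [← Real.rpow_add h0, ← Real.rpow_sub h0]
        congr 2
        ring

theorem distortionNorm_cuspMap_le (hγ : ∀ i, 1 ≤ γ i) (ha : 0 < a) (α : ℝ) {p s : ℝ}
    (hs : 0 < s) (hsp : s < p)
    (hd : 0 < ((m : ℝ) + 1) * p - s * (a * (α + cuspExponent γ - p) + p)) :
    distortionNorm p s (baseDomain m) (powerWeight α) (cuspMap γ a) ≤
      ENNReal.ofReal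
        (√((∑ i, (a * γ i - 1) ^ 2) + (m : ℝ) + a ^ 2) / (a * weightConst m α) ^ (1 / p) *
          ((p - s) / (((m : ℝ) + 1) * p - s * (a * (α + cuspExponent γ - p) + p))) ^
            ((p - s) / (p * s))) := by
  have h := smoothDiffeoOn_cuspMap hγ ha
  have hp : 0 < p := hs.trans hsp
  have hps : 0 < p - s := sub_pos.2 hsp
  have hc := weightConst_pos m α
  set C := √((∑ i, (a * γ i - 1) ^ 2) + (m : ℝ) + a ^ 2)
  have hC : 0 ≤ C := Real.sqrt_nonneg _
  set e := (m : ℝ) + 1 - p - a * (α + cuspExponent γ - p) with he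
  set d := ((m : ℝ) + 1) * p - s * (a * (α + cuspExponent γ - p) + p) with hd'
  set M := C ^ p / (a * weightConst m α) with hM
  have hM0 : 0 ≤ M := by positivity
  set r := s / (p - s) with hr
  have hr0 : 0 < r := div_pos hs hps
  have hδ : 0 ≤ (p - s) / (p * s) := by positivity
  -- This is the denominator of the slice integral. Since `p - s > 0`, it is positive exactly when
  -- `d` is, which is the condition on `s`.
  have hexp : e * r + (m + 1) = d / (p - s) := by
    rw [hr, he, hd']
    field_simp
    ring
  have hpt : ∀ x ∈ baseDomain m,
      (‖fderiv ℝ (cuspMap γ a) x‖ₑ ^ p /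
        (‖(fderiv ℝ (cuspMap γ a) x).det‖ₑ * (powerWeight α (cuspMap γ a x) : ℝ≥0∞))) ^ r ≤
      ENNReal.ofReal (M ^ r) * ENNReal.ofReal (x (Fin.last m) ^ (e * r)) := by
    intro x hx
    have ht := hx.1.1
    have hn := norm_pos_of_mem_cuspDomain (h.mapsTo hx)
    have hW : 0 < ‖cuspMap γ a x‖ ^ α := Real.rpow_pos_of_pos hn α
    have hJ : 0 < |(fderiv ℝ (cuspMap γ a) x).det| := abs_pos.2 (h.det_ne_zero hx)
    have e1 : (powerWeight α (cuspMap γ a x) : ℝ≥0∞) = ENNReal.ofReal (‖cuspMap γ a x‖ ^ α) := by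
      rw [powerWeight, ENNReal.ofReal, Real.toNNReal_rpow_of_nonneg (norm_nonneg _), norm_toNNReal]
    rw [e1, Real.enorm_eq_ofReal_abs, ← ofReal_norm,
      ENNReal.ofReal_rpow_of_nonneg (norm_nonneg _) hp.le, ← ENNReal.ofReal_mul hJ.le,
      ← ENNReal.ofReal_div_of_pos (mul_pos hJ hW),
      ENNReal.ofReal_rpow_of_nonneg (by positivity) hr0.le,
      ← ENNReal.ofReal_mul (Real.rpow_nonneg hM0 _)]
    refine ENNReal.ofReal_le_ofReal ?_
    rw [Real.rpow_mul ht.le, ← Real.mul_rpow hM0 (Real.rpow_nonneg ht.le _)]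
    exact Real.rpow_le_rpow (by positivity) (distortion_quotient_le hγ ha α hp hx) hr0.le
  have hint : ∫⁻ x in baseDomain m,
      (‖fderiv ℝ (cuspMap γ a) x‖ₑ ^ p /
        (‖(fderiv ℝ (cuspMap γ a) x).det‖ₑ * (powerWeight α (cuspMap γ a x) : ℝ≥0∞))) ^ r ≤
      ENNReal.ofReal (M ^ r * ((p - s) / d)) := by
    refine (setLIntegral_mono' h.isOpen_source.measurableSet hpt).trans_eq ?_
    rw [lintegral_const_mul' _ _ ENNReal.ofReal_ne_top,
      lintegral_baseDomain_rpow m (hexp ▸ div_pos hd hps), hexp, one_div_div,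
      ENNReal.ofReal_mul (Real.rpow_nonneg hM0 _)]
  rw [h.distortionNorm_eq]
  refine (ENNReal.rpow_le_rpow hint hδ).trans_eq ?_
  rw [ENNReal.ofReal_rpow_of_nonneg (by positivity) hδ,
    Real.mul_rpow (by positivity) (by positivity), ← Real.rpow_mul hM0]
  congr 2
  -- The inner and outer exponents combine to `1 / p`, so `M` contributes `C / (a c) ^ (1 / p)`.
  rw [show r * ((p - s) / (p * s)) = 1 / p by rw [hr]; field_simp, hM,
    Real.div_rpow (by positivity) (by positivity), ← Real.rpow_mul hC, mul_one_div_cancel hp.ne',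
    Real.rpow_one]

theorem isWeightedQuasiconformal_cuspMap (hγ : ∀ i, 1 ≤ γ i) (ha : 0 < a) {α p s : ℝ}
    (hs : 1 < s) (hsp : s < p)
    (hfin : distortionNorm p s (baseDomain m) (powerWeight α) (cuspMap γ a) < ⊤) :
    IsWeightedQuasiconformal p s (powerWeight α) (baseDomain m) (cuspDomain γ) (cuspMap γ a) := by
  have h := smoothDiffeoOn_cuspMap hγ ha
  have hbase : IsDomainSet (baseDomain m) := isLipschitzDomain_baseDomain.1
  refine ⟨hs, hsp, hbase, ⟨h.isOpen_target, ?_⟩, ⟨h.toHomeomorph, fun _ => rfl⟩,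
    h.finiteWeightedDistortion fun y hy => ?_, hfin⟩
  · rw [← h.image_eq]
    exact hbase.2.image _ h.contDiffOn.continuousOn
  · exact (NNReal.rpow_pos (norm_pos_of_mem_cuspDomain hy)).ne'

end CuspDistortion

theorem theorem2p2 (m : ℕ) (hm : 1 ≤ m) (γ : Fin m → ℝ) (hγ : ∀ i, 1 ≤ γ i) (α a : ℝ) :
    ∃ c : ℝ, 0 < c ∧ ∀ p : ℝ, 1 < p → p < α + cuspExponent γ →
      -((m : ℝ) + 1) < α → α < ((m : ℝ) + 1) * (p - 1) →
      max 0 (((m : ℝ) + 1 - p) / (α + cuspExponent γ - p)) < a →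
      a < p * (m : ℝ) / (α + cuspExponent γ - p) →
      (IsLipschitzDomain (baseDomain m) ∧ Convex ℝ (baseDomain m) ∧
        Bornology.IsBounded (cuspDomain γ)) ∧
      LuzinN (baseDomain m) (cuspMap γ a) ∧
      ∀ s : ℝ, 1 < s → s < ((m : ℝ) + 1) * p / (a * (α + cuspExponent γ - p) + p) →
        IsWeightedQuasiconformal p s (powerWeight α) (baseDomain m) (cuspDomain γ)
          (cuspMap γ a) ∧
        compositionNorm p s (baseDomain m) (cuspDomain γ) (powerWeight α) (cuspMap γ a) ≤
          distortionNorm p s (baseDomain m) (powerWeight α) (cuspMap γ a) ∧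
        distortionNorm p s (baseDomain m) (powerWeight α) (cuspMap γ a) ≤
          ENNReal.ofReal
            (Real.sqrt ((∑ i, (a * γ i - 1) ^ 2) + (m : ℝ) + a ^ 2) / (a * c) ^ (1 / p) *
              ((p - s) / (((m : ℝ) + 1) * p - s * (a * (α + cuspExponent γ - p) + p))) ^
                ((p - s) / (p * s))) := by
  refine ⟨weightConst m α, weightConst_pos m α, fun p hp hpα _ _ ha _ => ?_⟩
  have ha0 : 0 < a := (le_max_left _ _).trans_lt ha
  have hb : 0 < α + cuspExponent γ - p := sub_pos.2 hpα
  have hp0 : 0 < p := one_pos.trans hp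
  have h := smoothDiffeoOn_cuspMap hγ ha0
  refine ⟨⟨isLipschitzDomain_baseDomain, convex_baseDomain, isBounded_cuspDomain hγ⟩, h.luzinN,
    fun s hs hsu => ?_⟩
  have hD : 0 < a * (α + cuspExponent γ - p) + p := by positivity
  have han : (m : ℝ) + 1 - p < a * (α + cuspExponent γ - p) :=
    (div_lt_iff₀ hb).1 ((le_max_right _ _).trans_lt ha)
  have hd : s * (a * (α + cuspExponent γ - p) + p) < ((m : ℝ) + 1) * p := (lt_div_iff₀ hD).1 hsu
  -- The lower bound on `a` says `n < a (α + γ - p) + p`, so the upper bound on `s` lies below `p`.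
  have hsp : s < p := hsu.trans ((div_lt_iff₀ hD).2 (by nlinarith))
  have hs0 : 0 < s := one_pos.trans hs
  have hle := distortionNorm_cuspMap_le hγ ha0 α hs0 hsp (sub_pos.2 hd)
  have hfin := hle.trans_lt ENNReal.ofReal_lt_top
  refine ⟨isWeightedQuasiconformal_cuspMap hγ ha0 hs hsp hfin,
    h.compositionNorm_le_distortionNorm hs0 hsp ?_ (fun y hy => ?_) hfin, hle⟩
  · exact measurable_nnnorm.pow_const α
  · exact (NNReal.rpow_pos (norm_pos_of_mem_cuspDomain hy)).ne'
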